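/- Conventions. A genus-two curve over a field $k$ of characteristic $0$ is a curve $\mathcal C:\ y^2=f(x)$ with $f\in k[x]$ of degree $6$ without multiple roots. Let $F$ be the binary sextic form attached to $f$, and for binary forms $g,h$ of degrees $m,n$ let $$(g\,h)_r=\frac{(m-r)!\,(n-r)!}{m!\,n!}\sum_{i=0}^r(-1)^i\binom ri\,\frac{\partial^r g}{\partial X^{r-i}\partial Z^i}\,\frac{\partial^r h}{\partial X^i\partial Z^{r-i}}$$ be the $r$-th transvectant. With $\mathsf i=(F\,F)_4$, $\Delta=(\mathsf i\,\mathsf i)_2$, $\mathsf y_1=(F\,\mathsf i)_4$, $\mathsf y_2=(\mathsf i\,\mathsf y_1)_2$, $\mathsf y_3=(\mathsf i\,\mathsf y_2)_2$, the Clebsch invariants are $A=(F\,F)_6$, $B=(\mathsf i\,\mathsf i)_4$, $C=(\mathsf i\,\Delta)_4$, $D=(\mathsf y_3\,\mathsf y_1)_2$, and the Igusa invariants are $$I_2=-120A,\quad I_4=-720A^2+6750B,\quad I_6=8640A^3-108000AB+202500C,$$ $$I_{10}=-62208A^5+972000A^3B+1620000A^2C-3037500AB^2-6075000BC-4556250D$$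 (so $I_{10}$ is the discriminant of $f$). The absolute Igusa invariants of $\mathcal C$ are $$j_1(\mathcal C)=\frac{I_2^5}{I_{10}},\qquad j_2(\mathcal C)=\frac{I_4I_2^3}{I_{10}},\qquad j_3(\mathcal C)=\frac{I_6I_2^2}{I_{10}} .$$ Statement. Let $j_1,j_2,j_3$ be elements of a field of characteristic $0$ that are algebraically independent over $\mathbb Q$, put $K=\mathbb Q(j_1,j_2,j_3)$, and let $d$ be an element of that field with $$\begin{aligned} d^2=\frac{1}{2^{22}3^{36}5^{30}j_1^9}\Big(& j_2^4j_1^3-12j_2^3j_3j_1^3+54j_2^2j_3^2j_1^3-108j_2j_3^3j_1^3+81j_3^4j_1^3+78j_2^5j_1^2-1332j_2^4j_3j_1^2\\ &+8910j_2^3j_3^2j_1^2-29376j_2^2j_3^3j_1^2+47952j_2j_3^4j_1^2-31104j_3^5j_1^2-159j_2^6j_1+1728j_2^5j_3j_1\\ &-6048j_2^4j_3^2j_1+6912j_2^3j_3^3j_1+80j_2^7-384j_2^6j_3-972j_2^2j_1^4+5832j_2j_3j_1^4-8748j_3^2j_1^4\\ &-77436j_2^3j_1^3+870912j_2^2j_3j_1^3-3090960j_2j_3^2j_1^3+3499200j_3^3j_1^3+592272j_2^4j_1^2\\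 &-4743360j_2^3j_3j_1^2+9331200j_2^2j_3^2j_1^2-41472j_2^5j_1+236196j_1^5+19245600j_2j_1^4\\ &-104976000j_3j_1^4-507384000j_2^2j_1^3+2099520000j_2j_3j_1^3+125971200000j_1^4\Big)\\ &\times\big(9j_1^2+700j_2j_1-3600j_3j_1-12400j_2^2+48000j_2j_3+10800000j_1\big). \end{aligned}$$ Then there is a pair of distinct genus-two curves $\mathcal C^{\pm}:\ y^2=u(x)\pm d\,v(x)$, with $u,v\in K[x]$, defined over $K(d)=K[d]$, such that $$j_1(\mathcal C^\pm)=j_1,\qquad j_2(\mathcal C^\pm)=j_2,\qquad j_3(\mathcal C^\pm)=j_3 .$$ ("Distinct" means that the two sextics $u+dv$ and $u-dv$ differ.) -/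

import Mathlib

open Polynomial IntermediateField

noncomputable section

namespace GenusTwo

/-- The genus-two curve `y² = f(x)` over `k` (a field of characteristic zero in all uses),
given by a polynomial `f` of degree six without multiple roots. -/
@[ext]
structure Curve (k : Type*) [Field k] where
  sextic : k[X]
  natDegree_eq : sextic.natDegree = 6
  separable : sextic.Separable

section Invariants

variable {k : Type*} [Field k]

/-- The binary sextic form `F(X, Z) = ∑ cᵢ Xⁱ Z⁶⁻ⁱ` attached to `f(x) = ∑ cᵢ xⁱ`;
the variables are `X = X 0` and `Z = X 1`. -/
def binaryForm (f : k[X]) : MvPolynomial (Fin 2) k :=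
  ∑ i ∈ Finset.range 7,
    MvPolynomial.C (f.coeff i) * MvPolynomial.X 0 ^ i * MvPolynomial.X 1 ^ (6 - i)

/-- The partial derivative `∂ᵃ⁺ᵇ g / ∂Xᵃ ∂Zᵇ`. -/
def partialDeriv (a b : ℕ) (g : MvPolynomial (Fin 2) k) : MvPolynomial (Fin 2) k :=
  (MvPolynomial.pderiv 0)^[a] ((MvPolynomial.pderiv 1)^[b] g)

/-- The transvectant (Überschiebung) `(g h)ᵣ` of order `r ≤ min m n` of a binary form `g` of
degree `m` and a binary form `h` of degree `n`:
`(m-r)! (n-r)! / (m! n!) ∑ᵢ (-1)ⁱ (r choose i) ∂ʳg/∂Xʳ⁻ⁱ∂Zⁱ · ∂ʳh/∂Xⁱ∂Zʳ⁻ⁱ`. -/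
def transvectant (m n r : ℕ) (g h : MvPolynomial (Fin 2) k) : MvPolynomial (Fin 2) k :=
  MvPolynomial.C
      (((m - r).factorial * (n - r).factorial : k) / ((m.factorial : k) * (n.factorial : k))) *
    ∑ i ∈ Finset.range (r + 1), MvPolynomial.C ((-1) ^ i * (r.choose i : k)) *
      partialDeriv (r - i) i g * partialDeriv i (r - i) h

/-! The covariants used by Clebsch: with `F` the sextic form, the quartic `i = (F F)₄`, the
quartic `Δ = (i i)₂`, and the quadratics `y₁ = (F i)₄`, `y₂ = (i y₁)₂`, `y₃ = (i y₂)₂`. -/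

def covI (f : k[X]) : MvPolynomial (Fin 2) k := transvectant 6 6 4 (binaryForm f) (binaryForm f)

def covDelta (f : k[X]) : MvPolynomial (Fin 2) k := transvectant 4 4 2 (covI f) (covI f)

def covY₁ (f : k[X]) : MvPolynomial (Fin 2) k := transvectant 6 4 4 (binaryForm f) (covI f)

def covY₂ (f : k[X]) : MvPolynomial (Fin 2) k := transvectant 4 2 2 (covI f) (covY₁ f)

def covY₃ (f : k[X]) : MvPolynomial (Fin 2) k := transvectant 4 2 2 (covI f) (covY₂ f)

/-! The Clebsch invariants `A = (F F)₆`, `B = (i i)₄`, `C = (i Δ)₄`, `D = (y₃ y₁)₂` (forms of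
degree zero, regarded as elements of `k`). -/

def clebschA (f : k[X]) : k :=
  MvPolynomial.constantCoeff (transvectant 6 6 6 (binaryForm f) (binaryForm f))

def clebschB (f : k[X]) : k :=
  MvPolynomial.constantCoeff (transvectant 4 4 4 (covI f) (covI f))

def clebschC (f : k[X]) : k :=
  MvPolynomial.constantCoeff (transvectant 4 4 4 (covI f) (covDelta f))

def clebschD (f : k[X]) : k :=
  MvPolynomial.constantCoeff (transvectant 2 2 2 (covY₃ f) (covY₁ f))

/-! The Igusa (Igusa-Clebsch) invariants. -/

def I₂ (f : k[X]) : k := -120 * clebschA f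

def I₄ (f : k[X]) : k := -720 * clebschA f ^ 2 + 6750 * clebschB f

def I₆ (f : k[X]) : k :=
  8640 * clebschA f ^ 3 - 108000 * clebschA f * clebschB f + 202500 * clebschC f

/-- For a sextic `f` this is its discriminant. -/
def I₁₀ (f : k[X]) : k :=
  -62208 * clebschA f ^ 5 + 972000 * clebschA f ^ 3 * clebschB f
    + 1620000 * clebschA f ^ 2 * clebschC f - 3037500 * clebschA f * clebschB f ^ 2
    - 6075000 * clebschB f * clebschC f - 4556250 * clebschD f

/-! The absolute Igusa invariants (Igusa functions) of a genus-two curve. -/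

def Curve.absInv₁ (C : Curve k) : k := I₂ C.sextic ^ 5 / I₁₀ C.sextic

def Curve.absInv₂ (C : Curve k) : k := I₄ C.sextic * I₂ C.sextic ^ 3 / I₁₀ C.sextic

def Curve.absInv₃ (C : Curve k) : k := I₆ C.sextic * I₂ C.sextic ^ 2 / I₁₀ C.sextic

/-- The explicit rational function of `(j₁, j₂, j₃)` that gives `d²`. -/
def dSq (j₁ j₂ j₃ : k) : k :=
  1 / (2 ^ 22 * 3 ^ 36 * 5 ^ 30 * j₁ ^ 9) *
    (j₂ ^ 4 * j₁ ^ 3 - 12 * j₂ ^ 3 * j₃ * j₁ ^ 3 + 54 * j₂ ^ 2 * j₃ ^ 2 * j₁ ^ 3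
      - 108 * j₂ * j₃ ^ 3 * j₁ ^ 3 + 81 * j₃ ^ 4 * j₁ ^ 3 + 78 * j₂ ^ 5 * j₁ ^ 2
      - 1332 * j₂ ^ 4 * j₃ * j₁ ^ 2 + 8910 * j₂ ^ 3 * j₃ ^ 2 * j₁ ^ 2
      - 29376 * j₂ ^ 2 * j₃ ^ 3 * j₁ ^ 2 + 47952 * j₂ * j₃ ^ 4 * j₁ ^ 2
      - 31104 * j₃ ^ 5 * j₁ ^ 2 - 159 * j₂ ^ 6 * j₁ + 1728 * j₂ ^ 5 * j₃ * j₁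
      - 6048 * j₂ ^ 4 * j₃ ^ 2 * j₁ + 6912 * j₂ ^ 3 * j₃ ^ 3 * j₁
      + 80 * j₂ ^ 7 - 384 * j₂ ^ 6 * j₃ - 972 * j₂ ^ 2 * j₁ ^ 4
      + 5832 * j₂ * j₃ * j₁ ^ 4 - 8748 * j₃ ^ 2 * j₁ ^ 4 - 77436 * j₂ ^ 3 * j₁ ^ 3
      + 870912 * j₂ ^ 2 * j₃ * j₁ ^ 3 - 3090960 * j₂ * j₃ ^ 2 * j₁ ^ 3
      + 3499200 * j₃ ^ 3 * j₁ ^ 3 + 592272 * j₂ ^ 4 * j₁ ^ 2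
      - 4743360 * j₂ ^ 3 * j₃ * j₁ ^ 2 + 9331200 * j₂ ^ 2 * j₃ ^ 2 * j₁ ^ 2
      - 41472 * j₂ ^ 5 * j₁ + 236196 * j₁ ^ 5 + 19245600 * j₂ * j₁ ^ 4
      - 104976000 * j₃ * j₁ ^ 4 - 507384000 * j₂ ^ 2 * j₁ ^ 3
      + 2099520000 * j₂ * j₃ * j₁ ^ 3 + 125971200000 * j₁ ^ 4) *
    (9 * j₁ ^ 2 + 700 * j₂ * j₁ - 3600 * j₃ * j₁ - 12400 * j₂ ^ 2 + 48000 * j₂ * j₃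
      + 10800000 * j₁)

/-- The field `ℚ(j₁, j₂, j₃)`, inside a field `k` of characteristic zero. -/
abbrev moduliField [CharZero k] (j₁ j₂ j₃ : k) : IntermediateField ℚ k :=
  IntermediateField.adjoin ℚ {j₁, j₂, j₃}

end Invariants

end GenusTwo

end

namespace GenusTwo

/-! ### Transvectants: equivariance under linear substitution and base change. -/

section Transvectants

open MvPolynomial (pderiv)

variable {k : Type*} [Field k]

/-! This is Mestre's reconstruction of a genus-two curve from its invariants, on a conic that
acquires a rational point once `d` is adjoined.

Let `T = (i ·)₂`, acting on binary quadratics. It is self-adjoint for `(· ·)₂` and `yₙ₊₁ = T yₙ`, so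
`(yᵢ yⱼ)₂` depends only on `i + j`: the Gram matrix of `y₁, y₂, y₃` is a Hankel matrix of moments,
polynomial in `A, B, C, D`. A combination `x y₁ + y y₂ + z y₃` is the square `(PX + QZ)²` of a
linear form exactly on the conic of this matrix, and there the cubic `(F, (x y₁ + y y₂ + z y₃)³)₆`
takes the value `F(Q, -P)`. Restricting the cubic to a parametrised conic therefore recovers `F` up
to a linear substitution and a scalar (`binaryForm_mestreSextic`), and both leave the absolute
invariants unchanged (`exists_clebsch_mestreSextic`).

To know that an `F` with prescribed `A, B, C, D` exists, and that its cubic is `mestreCubic`, one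
works over an algebraic closure, where `i` can be taken in the form `α X⁴ + 6β X²Z² + α Z⁴` and `T`
is diagonal; `diagForm` is then an explicit solution.

Rationality: write `s₀, …, s₄` for the moments, `M = s₀s₂ - s₁²`, `m = s₂² - s₁s₃`. Completing
squares, first in `y` and then in `x`, `M s₂` times the conic is `M (s₂y + s₁x + s₃z)² + (Mx + mz)²
+ s₂ det z²`. With `δ² = -s₂ det` the last two terms factor, which gives a point and a
parametrisation over `K(δ)`. By `mul_dSq_eq`, `d` is such a `δ` up to a factor in `K`. Expanding the
restricted cubic in powers of `δ` gives `u + δ v` with `u, v` over `K`, and `δ ↦ -δ` gives the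
second curve.

The remaining requirements (distinct eigenvalues, nonzero minors, degree six, distinct sextics) are
nonvanishing statements for polynomials in `j₁, j₂, j₃`; algebraic independence reduces each to one
numerical evaluation. -/

theorem pderiv_comm (g : MvPolynomial (Fin 2) k) :
    pderiv 0 (pderiv 1 g) = pderiv 1 (pderiv 0 g) := by
  let D : Fin 2 → Derivation k (MvPolynomial (Fin 2) k) (MvPolynomial (Fin 2) k) := pderiv
  have h : ⁅D 0, D 1⁆ = 0 := by
    refine MvPolynomial.derivation_ext fun i => ?_
    fin_cases i <;> simp [D, Derivation.commutator_apply, MvPolynomial.pderiv_X]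
  have := congrArg (fun D' => D' g) h
  simpa [D, Derivation.commutator_apply, sub_eq_zero] using this

/-- Cayley's omega process, iterated `r` times and restricted to the diagonal. -/
noncomputable def omega :
    ℕ → MvPolynomial (Fin 2) k → MvPolynomial (Fin 2) k → MvPolynomial (Fin 2) k
  | 0, g, h => g * h
  | r + 1, g, h => omega r (pderiv 0 g) (pderiv 1 h) - omega r (pderiv 1 g) (pderiv 0 h)

theorem omega_add_left (r : ℕ) (g g' h : MvPolynomial (Fin 2) k) :
    omega r (g + g') h = omega r g h + omega r g' h := by
  induction r generalizing g g' h with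
  | zero => simp [omega, add_mul]
  | succ r ih => simp only [omega, map_add, ih]; ring

theorem omega_add_right (r : ℕ) (g h h' : MvPolynomial (Fin 2) k) :
    omega r g (h + h') = omega r g h + omega r g h' := by
  induction r generalizing g h h' with
  | zero => simp [omega, mul_add]
  | succ r ih => simp only [omega, map_add, ih]; ring

theorem omega_C_mul_left (r : ℕ) (c : k) (g h : MvPolynomial (Fin 2) k) :
    omega r (MvPolynomial.C c * g) h = MvPolynomial.C c * omega r g h := by
  induction r generalizing g h with
  | zero => simp [omega, mul_assoc]
  | succ r ih => simp only [omega, MvPolynomial.pderiv_C_mul, ih]; ring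

theorem omega_C_mul_right (r : ℕ) (c : k) (g h : MvPolynomial (Fin 2) k) :
    omega r g (MvPolynomial.C c * h) = MvPolynomial.C c * omega r g h := by
  induction r generalizing g h with
  | zero => simp only [omega]; ring
  | succ r ih => simp only [omega, MvPolynomial.pderiv_C_mul, ih]; ring

/-- The linear substitution `X ↦ aX + bZ`, `Z ↦ cX + dZ`. -/
noncomputable def linSubst (a b c d : k) : MvPolynomial (Fin 2) k →ₐ[k] MvPolynomial (Fin 2) k :=
  MvPolynomial.aeval
    ![MvPolynomial.C a * MvPolynomial.X 0 + MvPolynomial.C b * MvPolynomial.X 1,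
      MvPolynomial.C c * MvPolynomial.X 0 + MvPolynomial.C d * MvPolynomial.X 1]

@[simp] theorem linSubst_X_zero (a b c d : k) : linSubst a b c d (MvPolynomial.X 0) =
    MvPolynomial.C a * MvPolynomial.X 0 + MvPolynomial.C b * MvPolynomial.X 1 := by
  simp [linSubst]

@[simp] theorem linSubst_X_one (a b c d : k) : linSubst a b c d (MvPolynomial.X 1) =
    MvPolynomial.C c * MvPolynomial.X 0 + MvPolynomial.C d * MvPolynomial.X 1 := by
  simp [linSubst]

@[simp] theorem linSubst_C (a b c d e : k) :
    linSubst a b c d (MvPolynomial.C e) = MvPolynomial.C e :=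
  (linSubst a b c d).commutes e

theorem constantCoeff_linSubst (a b c d : k) (g : MvPolynomial (Fin 2) k) :
    MvPolynomial.constantCoeff (linSubst a b c d g) = MvPolynomial.constantCoeff g := by
  induction g using MvPolynomial.induction_on with
  | C e => simp
  | add p q hp hq => simp [hp, hq]
  | mul_X p i hp => fin_cases i <;> simp

theorem pderiv_zero_linSubst (a b c d : k) (g : MvPolynomial (Fin 2) k) :
    pderiv 0 (linSubst a b c d g) =
      MvPolynomial.C a * linSubst a b c d (pderiv 0 g) +
        MvPolynomial.C c * linSubst a b c d (pderiv 1 g) := by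
  induction g using MvPolynomial.induction_on with
  | C e => simp
  | add p q hp hq => simp only [map_add, hp, hq]; ring
  | mul_X p i hp =>
    fin_cases i <;>
    · simp [hp, Derivation.leibniz, MvPolynomial.pderiv_X]
      ring

theorem pderiv_one_linSubst (a b c d : k) (g : MvPolynomial (Fin 2) k) :
    pderiv 1 (linSubst a b c d g) =
      MvPolynomial.C b * linSubst a b c d (pderiv 0 g) +
        MvPolynomial.C d * linSubst a b c d (pderiv 1 g) := by
  induction g using MvPolynomial.induction_on with
  | C e => simp
  | add p q hp hq => simp only [map_add, hp, hq]; ring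
  | mul_X p i hp =>
    fin_cases i <;>
    · simp [hp, Derivation.leibniz, MvPolynomial.pderiv_X]
      ring

/-- By the chain rule the operator `∂X ⊗ ∂Z - ∂Z ⊗ ∂X` is a `2 × 2` determinant in the derivatives,
so each step contributes one factor `ad - bc`. -/
theorem omega_linSubst (a b c d : k) (r : ℕ) (g h : MvPolynomial (Fin 2) k) :
    omega r (linSubst a b c d g) (linSubst a b c d h) =
      MvPolynomial.C ((a * d - b * c) ^ r) * linSubst a b c d (omega r g h) := by
  induction r generalizing g h with
  | zero => simp [omega]
  | succ r ih =>
    simp only [omega, pderiv_zero_linSubst, pderiv_one_linSubst, omega_add_left, omega_add_right,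
      omega_C_mul_left, omega_C_mul_right, ih, map_sub, pow_succ, map_mul]
    ring

/-- The binomial theorem for the commuting operators `P = ∂X ⊗ ∂Z` and `Q = -∂Z ⊗ ∂X` on the tensor
square, followed by multiplication. It links the recursive form, suited to induction, with the
defining sum. -/
theorem omega_eq_sum (r : ℕ) (g h : MvPolynomial (Fin 2) k) :
    omega r g h = ∑ i ∈ Finset.range (r + 1), MvPolynomial.C ((-1) ^ i * (r.choose i : k)) *
      partialDeriv (r - i) i g * partialDeriv i (r - i) h := by
  let dX : Module.End k (MvPolynomial (Fin 2) k) := (pderiv 0).toLinearMap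
  let dZ : Module.End k (MvPolynomial (Fin 2) k) := (pderiv 1).toLinearMap
  let P : Module.End k (TensorProduct k (MvPolynomial (Fin 2) k) (MvPolynomial (Fin 2) k)) :=
    TensorProduct.map dX dZ
  let Q : Module.End k (TensorProduct k (MvPolynomial (Fin 2) k) (MvPolynomial (Fin 2) k)) :=
    TensorProduct.map ((-1 : k) • dZ) dX
  have hc : Commute dX dZ := LinearMap.ext fun g => pderiv_comm g
  have hPQ : Commute Q P := by
    change Q * P = P * Q
    simp only [P, Q, ← TensorProduct.map_mul]
    rw [hc.eq, (hc.smul_right (-1 : k)).eq]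
  have h₁ : ∀ g h, omega r g h = LinearMap.mul' k _ (((Q + P) ^ r) (g ⊗ₜ[k] h)) := by
    induction r with
    | zero => intro g h; simp [omega]
    | succ r ih =>
      intro g h
      have h₀ : Q (g ⊗ₜ[k] h) = (-1 : k) • (pderiv 1 g ⊗ₜ[k] pderiv 0 h) := rfl
      rw [pow_succ, Module.End.mul_apply, LinearMap.add_apply, map_add, map_add, omega, ih, ih, h₀,
        map_smul, map_smul, neg_one_smul, neg_add_eq_sub]
      rfl
  have h₂ : ∀ a b g, (dX ^ a * dZ ^ b) g = partialDeriv a b g := by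
    intro a b g
    rw [Module.End.mul_apply, Module.End.pow_apply, Module.End.pow_apply]
    rfl
  rw [h₁, hPQ.add_pow]
  simp only [LinearMap.sum_apply, map_sum]
  refine Finset.sum_congr rfl fun i _ => ?_
  have h₃ : Q ^ i * P ^ (r - i) =
      TensorProduct.map ((-1 : k) ^ i • (dX ^ (r - i) * dZ ^ i)) (dX ^ i * dZ ^ (r - i)) := by
    rw [(hc.pow_pow (r - i) i).eq, ← smul_mul_assoc, ← _root_.smul_pow, TensorProduct.map_mul,
      TensorProduct.map_pow, TensorProduct.map_pow]
  rw [h₃, ← nsmul_eq_mul', LinearMap.smul_apply, TensorProduct.map_tmul, LinearMap.smul_apply,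
    h₂, h₂, map_nsmul, LinearMap.mul'_apply, MvPolynomial.smul_eq_C_mul, nsmul_eq_mul]
  simp only [map_mul, map_natCast]
  ring

theorem transvectant_eq_omega (m n r : ℕ) (g h : MvPolynomial (Fin 2) k) :
    transvectant m n r g h = MvPolynomial.C
      (((m - r).factorial * (n - r).factorial : k) / ((m.factorial : k) * (n.factorial : k))) *
      omega r g h := by
  rw [transvectant, omega_eq_sum]

theorem transvectant_linSubst (a b c d : k) (m n r : ℕ)
    (g h : MvPolynomial (Fin 2) k) :
    transvectant m n r (linSubst a b c d g) (linSubst a b c d h) =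
      MvPolynomial.C ((a * d - b * c) ^ r) * linSubst a b c d (transvectant m n r g h) := by
  rw [transvectant_eq_omega, transvectant_eq_omega, omega_linSubst, map_mul,
    linSubst_C]
  ring

theorem transvectant_C_mul_left (c : k) (m n r : ℕ)
    (g h : MvPolynomial (Fin 2) k) :
    transvectant m n r (MvPolynomial.C c * g) h = MvPolynomial.C c * transvectant m n r g h := by
  rw [transvectant_eq_omega, transvectant_eq_omega, omega_C_mul_left]
  ring

theorem transvectant_C_mul_right (c : k) (m n r : ℕ)
    (g h : MvPolynomial (Fin 2) k) :
    transvectant m n r g (MvPolynomial.C c * h) = MvPolynomial.C c * transvectant m n r g h := by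
  rw [transvectant_eq_omega, transvectant_eq_omega, omega_C_mul_right]
  ring

theorem omega_map {l : Type*} [Field l] (φ : k →+* l) (r : ℕ) (g h : MvPolynomial (Fin 2) k) :
    omega r (MvPolynomial.map φ g) (MvPolynomial.map φ h) =
      MvPolynomial.map φ (omega r g h) := by
  induction r generalizing g h with
  | zero => simp [omega]
  | succ r ih => simp only [omega, MvPolynomial.pderiv_map, ih, map_sub]

theorem transvectant_map {l : Type*} [Field l] (φ : k →+* l) (m n r : ℕ)
    (g h : MvPolynomial (Fin 2) k) :
    transvectant m n r (MvPolynomial.map φ g) (MvPolynomial.map φ h) =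
      MvPolynomial.map φ (transvectant m n r g h) := by
  rw [transvectant_eq_omega, transvectant_eq_omega, omega_map, map_mul,
    MvPolynomial.map_C]
  simp

end Transvectants

/-! ### Transvectants of explicit forms of degree at most six. -/

section ExplicitForms

open MvPolynomial (pderiv)

variable {k : Type*} [Field k]

/-! Binary forms of small degree with binomial coefficients normalised away. -/

noncomputable def linForm (a b : k) : MvPolynomial (Fin 2) k :=
  MvPolynomial.C a * MvPolynomial.X 0 + MvPolynomial.C b * MvPolynomial.X 1

noncomputable def quadForm (a b c : k) : MvPolynomial (Fin 2) k :=
  MvPolynomial.C a * MvPolynomial.X 0 ^ 2 +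
    2 * MvPolynomial.C b * MvPolynomial.X 0 * MvPolynomial.X 1 +
    MvPolynomial.C c * MvPolynomial.X 1 ^ 2

noncomputable def cubicForm (a b c d : k) : MvPolynomial (Fin 2) k :=
  MvPolynomial.C a * MvPolynomial.X 0 ^ 3 +
    3 * MvPolynomial.C b * MvPolynomial.X 0 ^ 2 * MvPolynomial.X 1 +
    3 * MvPolynomial.C c * MvPolynomial.X 0 * MvPolynomial.X 1 ^ 2 +
    MvPolynomial.C d * MvPolynomial.X 1 ^ 3

noncomputable def quartForm (a b c d e : k) : MvPolynomial (Fin 2) k :=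
  MvPolynomial.C a * MvPolynomial.X 0 ^ 4 +
    4 * MvPolynomial.C b * MvPolynomial.X 0 ^ 3 * MvPolynomial.X 1 +
    6 * MvPolynomial.C c * MvPolynomial.X 0 ^ 2 * MvPolynomial.X 1 ^ 2 +
    4 * MvPolynomial.C d * MvPolynomial.X 0 * MvPolynomial.X 1 ^ 3 +
    MvPolynomial.C e * MvPolynomial.X 1 ^ 4

noncomputable def quintForm (a b c d e f : k) : MvPolynomial (Fin 2) k :=
  MvPolynomial.C a * MvPolynomial.X 0 ^ 5 +
    5 * MvPolynomial.C b * MvPolynomial.X 0 ^ 4 * MvPolynomial.X 1 +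
    10 * MvPolynomial.C c * MvPolynomial.X 0 ^ 3 * MvPolynomial.X 1 ^ 2 +
    10 * MvPolynomial.C d * MvPolynomial.X 0 ^ 2 * MvPolynomial.X 1 ^ 3 +
    5 * MvPolynomial.C e * MvPolynomial.X 0 * MvPolynomial.X 1 ^ 4 +
    MvPolynomial.C f * MvPolynomial.X 1 ^ 5

noncomputable def sexticForm (a b c d e f g : k) : MvPolynomial (Fin 2) k :=
  MvPolynomial.C a * MvPolynomial.X 0 ^ 6 +
    6 * MvPolynomial.C b * MvPolynomial.X 0 ^ 5 * MvPolynomial.X 1 +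
    15 * MvPolynomial.C c * MvPolynomial.X 0 ^ 4 * MvPolynomial.X 1 ^ 2 +
    20 * MvPolynomial.C d * MvPolynomial.X 0 ^ 3 * MvPolynomial.X 1 ^ 3 +
    15 * MvPolynomial.C e * MvPolynomial.X 0 ^ 2 * MvPolynomial.X 1 ^ 4 +
    6 * MvPolynomial.C f * MvPolynomial.X 0 * MvPolynomial.X 1 ^ 5 +
    MvPolynomial.C g * MvPolynomial.X 1 ^ 6

theorem pderiv_ofNat (i : Fin 2) (n : ℕ) [n.AtLeastTwo] :
    pderiv i (ofNat(n) : MvPolynomial (Fin 2) k) = 0 := by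
  rw [← map_ofNat MvPolynomial.C n, MvPolynomial.pderiv_C]

theorem pderiv_zero_linForm (a b : k) : pderiv 0 (linForm a b) = MvPolynomial.C a := by
  simp [linForm, MvPolynomial.pderiv_X]

theorem pderiv_one_linForm (a b : k) : pderiv 1 (linForm a b) = MvPolynomial.C b := by
  simp [linForm, MvPolynomial.pderiv_X]

theorem pderiv_zero_quadForm (a b c : k) :
    pderiv 0 (quadForm a b c) = MvPolynomial.C 2 * linForm a b := by
  simp [quadForm, linForm, Derivation.leibniz, Derivation.leibniz_pow,
    MvPolynomial.pderiv_X, pderiv_ofNat, map_ofNat MvPolynomial.C]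
  ring

theorem pderiv_one_quadForm (a b c : k) :
    pderiv 1 (quadForm a b c) = MvPolynomial.C 2 * linForm b c := by
  simp [quadForm, linForm, Derivation.leibniz, Derivation.leibniz_pow,
    MvPolynomial.pderiv_X, pderiv_ofNat, map_ofNat MvPolynomial.C]
  ring

theorem pderiv_zero_cubicForm (a b c d : k) :
    pderiv 0 (cubicForm a b c d) = MvPolynomial.C 3 * quadForm a b c := by
  simp [cubicForm, quadForm, Derivation.leibniz, Derivation.leibniz_pow,
    MvPolynomial.pderiv_X, pderiv_ofNat, map_ofNat MvPolynomial.C]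
  ring

theorem pderiv_one_cubicForm (a b c d : k) :
    pderiv 1 (cubicForm a b c d) = MvPolynomial.C 3 * quadForm b c d := by
  simp [cubicForm, quadForm, Derivation.leibniz, Derivation.leibniz_pow,
    MvPolynomial.pderiv_X, pderiv_ofNat, map_ofNat MvPolynomial.C]
  ring

theorem pderiv_zero_quartForm (a b c d e : k) :
    pderiv 0 (quartForm a b c d e) = MvPolynomial.C 4 * cubicForm a b c d := by
  simp [quartForm, cubicForm, Derivation.leibniz, Derivation.leibniz_pow,
    MvPolynomial.pderiv_X, pderiv_ofNat, map_ofNat MvPolynomial.C]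
  ring

theorem pderiv_one_quartForm (a b c d e : k) :
    pderiv 1 (quartForm a b c d e) = MvPolynomial.C 4 * cubicForm b c d e := by
  simp [quartForm, cubicForm, Derivation.leibniz, Derivation.leibniz_pow,
    MvPolynomial.pderiv_X, pderiv_ofNat, map_ofNat MvPolynomial.C]
  ring

theorem pderiv_zero_quintForm (a b c d e f : k) :
    pderiv 0 (quintForm a b c d e f) = MvPolynomial.C 5 * quartForm a b c d e := by
  simp [quintForm, quartForm, Derivation.leibniz, Derivation.leibniz_pow,
    MvPolynomial.pderiv_X, pderiv_ofNat, map_ofNat MvPolynomial.C]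
  ring

theorem pderiv_one_quintForm (a b c d e f : k) :
    pderiv 1 (quintForm a b c d e f) = MvPolynomial.C 5 * quartForm b c d e f := by
  simp [quintForm, quartForm, Derivation.leibniz, Derivation.leibniz_pow,
    MvPolynomial.pderiv_X, pderiv_ofNat, map_ofNat MvPolynomial.C]
  ring

theorem pderiv_zero_sexticForm (a b c d e f g : k) :
    pderiv 0 (sexticForm a b c d e f g) = MvPolynomial.C 6 * quintForm a b c d e f := by
  simp [sexticForm, quintForm, Derivation.leibniz, Derivation.leibniz_pow,
    MvPolynomial.pderiv_X, pderiv_ofNat, map_ofNat MvPolynomial.C]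
  ring

theorem pderiv_one_sexticForm (a b c d e f g : k) :
    pderiv 1 (sexticForm a b c d e f g) = MvPolynomial.C 6 * quintForm b c d e f g := by
  simp [sexticForm, quintForm, Derivation.leibniz, Derivation.leibniz_pow,
    MvPolynomial.pderiv_X, pderiv_ofNat, map_ofNat MvPolynomial.C]
  ring

variable [CharZero k]

theorem transvectant_quadForm_two (a b c a' b' c' : k) :
    transvectant 2 2 2 (quadForm a b c) (quadForm a' b' c') =
      MvPolynomial.C (a * c' - 2 * b * b' + c * a') := by
  simp only [transvectant_eq_omega, omega, pderiv_zero_quadForm, pderiv_one_quadForm,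
    MvPolynomial.pderiv_C_mul, pderiv_zero_linForm, pderiv_one_linForm, ← map_mul, ← map_sub]
  congr 1
  norm_num [Nat.factorial]
  ring

theorem transvectant_quartForm_quadForm_two (i₀ i₁ i₂ i₃ i₄ a b c : k) :
    transvectant 4 2 2 (quartForm i₀ i₁ i₂ i₃ i₄)
      (quadForm a b c) =
      quadForm (i₀ * c - 2 * i₁ * b + i₂ * a) (i₁ * c - 2 * i₂ * b + i₃ * a)
        (i₂ * c - 2 * i₃ * b + i₄ * a) := by
  have key : omega 2 (quartForm i₀ i₁ i₂ i₃ i₄) (quadForm a b c) =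
      MvPolynomial.C 24 * quadForm (i₀ * c - 2 * i₁ * b + i₂ * a) (i₁ * c - 2 * i₂ * b + i₃ * a)
        (i₂ * c - 2 * i₃ * b + i₄ * a) := by
    simp only [omega, pderiv_zero_linForm, pderiv_one_linForm, pderiv_zero_quadForm,
      pderiv_one_quadForm,
    pderiv_zero_cubicForm, pderiv_one_cubicForm, pderiv_zero_quartForm, pderiv_one_quartForm,
    MvPolynomial.pderiv_C_mul]
    simp only [quadForm, map_add, map_sub, map_mul, map_ofNat]
    ring
  rw [transvectant_eq_omega, key, ← mul_assoc, ← map_mul]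
  norm_num [Nat.factorial]

/-- The middle coefficient has a denominator `3`; introducing it as `c` through the equation `h`
keeps the computation polynomial. -/
theorem transvectant_quartForm_two_self (i₀ i₁ i₂ i₃ i₄ c : k)
    (h : 3 * c = i₀ * i₄ + 2 * i₁ * i₃ - 3 * i₂ * i₂) :
    transvectant 4 4 2 (quartForm i₀ i₁ i₂ i₃ i₄)
      (quartForm i₀ i₁ i₂ i₃ i₄) =
      quartForm (2 * (i₀ * i₂ - i₁ * i₁)) (i₀ * i₃ - i₁ * i₂)
        c (i₁ * i₄ - i₂ * i₃) (2 * (i₂ * i₄ - i₃ * i₃)) := by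
  have key : omega 2 (quartForm i₀ i₁ i₂ i₃ i₄) (quartForm i₀ i₁ i₂ i₃ i₄) =
      MvPolynomial.C 144 * quartForm (2 * (i₀ * i₂ - i₁ * i₁)) (i₀ * i₃ - i₁ * i₂)
        c (i₁ * i₄ - i₂ * i₃) (2 * (i₂ * i₄ - i₃ * i₃)) := by
    simp only [omega,
    pderiv_zero_cubicForm, pderiv_one_cubicForm, pderiv_zero_quartForm, pderiv_one_quartForm,
    MvPolynomial.pderiv_C_mul]
    have h' := congrArg (MvPolynomial.C (σ := Fin 2)) h
    simp only [map_add, map_sub, map_mul, map_ofNat] at h'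
    simp only [quartForm, quadForm, map_sub, map_mul, map_ofNat]
    linear_combination -288 * MvPolynomial.X 0 ^ 2 * MvPolynomial.X 1 ^ 2 * h'
  rw [transvectant_eq_omega, key, ← mul_assoc, ← map_mul]
  norm_num [Nat.factorial]

theorem transvectant_quartForm_four (i₀ i₁ i₂ i₃ i₄ j₀ j₁ j₂ j₃ j₄ : k) :
    transvectant 4 4 4 (quartForm i₀ i₁ i₂ i₃ i₄)
      (quartForm j₀ j₁ j₂ j₃ j₄) =
      MvPolynomial.C (i₀ * j₄ - 4 * i₁ * j₃ + 6 * i₂ * j₂ - 4 * i₃ * j₁ + i₄ * j₀) := by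
  have key : omega 4 (quartForm i₀ i₁ i₂ i₃ i₄) (quartForm j₀ j₁ j₂ j₃ j₄) =
      MvPolynomial.C 576 * MvPolynomial.C (i₀ * j₄ - 4 * i₁ * j₃ + 6 * i₂ * j₂ - 4 * i₃ * j₁ +
        i₄ * j₀) := by
    simp only [omega, pderiv_zero_linForm, pderiv_one_linForm, pderiv_zero_quadForm,
      pderiv_one_quadForm,
    pderiv_zero_cubicForm, pderiv_one_cubicForm, pderiv_zero_quartForm, pderiv_one_quartForm,
    MvPolynomial.pderiv_C_mul]
    simp only [map_add, map_sub, map_mul, map_ofNat]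
    ring
  rw [transvectant_eq_omega, key, ← mul_assoc, ← map_mul]
  norm_num [Nat.factorial]

theorem transvectant_sexticForm_quartForm_four (a₀ a₁ a₂ a₃ a₄ a₅ a₆ i₀ i₁ i₂ i₃ i₄ : k) :
    transvectant 6 4 4 (sexticForm a₀ a₁ a₂ a₃ a₄ a₅ a₆)
      (quartForm i₀ i₁ i₂ i₃ i₄) =
      quadForm (a₀ * i₄ - 4 * a₁ * i₃ + 6 * a₂ * i₂ - 4 * a₃ * i₁ + a₄ * i₀)
        (a₁ * i₄ - 4 * a₂ * i₃ + 6 * a₃ * i₂ - 4 * a₄ * i₁ + a₅ * i₀)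
        (a₂ * i₄ - 4 * a₃ * i₃ + 6 * a₄ * i₂ - 4 * a₅ * i₁ + a₆ * i₀) := by
  have key : omega 4 (sexticForm a₀ a₁ a₂ a₃ a₄ a₅ a₆) (quartForm i₀ i₁ i₂ i₃ i₄) =
      MvPolynomial.C 8640 * quadForm (a₀ * i₄ - 4 * a₁ * i₃ + 6 * a₂ * i₂ - 4 * a₃ * i₁ + a₄ * i₀)
        (a₁ * i₄ - 4 * a₂ * i₃ + 6 * a₃ * i₂ - 4 * a₄ * i₁ + a₅ * i₀)
        (a₂ * i₄ - 4 * a₃ * i₃ + 6 * a₄ * i₂ - 4 * a₅ * i₁ + a₆ * i₀) := by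
    simp only [omega, pderiv_zero_linForm, pderiv_one_linForm, pderiv_zero_quadForm,
      pderiv_one_quadForm,
    pderiv_zero_cubicForm, pderiv_one_cubicForm, pderiv_zero_quartForm, pderiv_one_quartForm,
    pderiv_zero_quintForm, pderiv_one_quintForm, pderiv_zero_sexticForm, pderiv_one_sexticForm,
    MvPolynomial.pderiv_C_mul]
    simp only [quadForm, map_add, map_sub, map_mul, map_ofNat]
    ring
  rw [transvectant_eq_omega, key, ← mul_assoc, ← map_mul]
  norm_num [Nat.factorial]

theorem transvectant_sexticForm_four_self (a₀ a₁ a₂ a₃ a₄ a₅ a₆ c : k)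
    (h : 3 * c = a₀ * a₆ - 9 * a₂ * a₄ + 8 * a₃ * a₃) :
    transvectant 6 6 4 (sexticForm a₀ a₁ a₂ a₃ a₄ a₅ a₆)
      (sexticForm a₀ a₁ a₂ a₃ a₄ a₅ a₆) =
      quartForm (2 * (a₀ * a₄ - 4 * a₁ * a₃ + 3 * a₂ * a₂)) (a₀ * a₅ - 3 * a₁ * a₄ + 2 * a₂ * a₃)
        c (a₁ * a₆ - 3 * a₂ * a₅ + 2 * a₃ * a₄)
        (2 * (a₂ * a₆ - 4 * a₃ * a₅ + 3 * a₄ * a₄)) := by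
  have key : omega 4 (sexticForm a₀ a₁ a₂ a₃ a₄ a₅ a₆) (sexticForm a₀ a₁ a₂ a₃ a₄ a₅ a₆) =
      MvPolynomial.C 129600 * quartForm (2 * (a₀ * a₄ - 4 * a₁ * a₃ + 3 * a₂ * a₂)) (a₀ * a₅ -
        3 * a₁ * a₄ + 2 * a₂ * a₃)
        c (a₁ * a₆ - 3 * a₂ * a₅ + 2 * a₃ * a₄)
        (2 * (a₂ * a₆ - 4 * a₃ * a₅ + 3 * a₄ * a₄)) := by
    simp only [omega,
    pderiv_zero_cubicForm, pderiv_one_cubicForm, pderiv_zero_quartForm, pderiv_one_quartForm,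
    pderiv_zero_quintForm, pderiv_one_quintForm, pderiv_zero_sexticForm, pderiv_one_sexticForm,
    MvPolynomial.pderiv_C_mul]
    have h' := congrArg (MvPolynomial.C (σ := Fin 2)) h
    simp only [map_add, map_sub, map_mul, map_ofNat] at h'
    simp only [quartForm, quadForm, map_add, map_sub, map_mul, map_ofNat]
    linear_combination -259200 * MvPolynomial.X 0 ^ 2 * MvPolynomial.X 1 ^ 2 * h'
  rw [transvectant_eq_omega, key, ← mul_assoc, ← map_mul]
  norm_num [Nat.factorial]

theorem transvectant_sexticForm_six_self (a₀ a₁ a₂ a₃ a₄ a₅ a₆ : k) :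
    transvectant 6 6 6 (sexticForm a₀ a₁ a₂ a₃ a₄ a₅ a₆)
      (sexticForm a₀ a₁ a₂ a₃ a₄ a₅ a₆) =
      MvPolynomial.C (2 * (a₀ * a₆ - 6 * a₁ * a₅ + 15 * a₂ * a₄ - 10 * a₃ * a₃)) := by
  have key : omega 6 (sexticForm a₀ a₁ a₂ a₃ a₄ a₅ a₆) (sexticForm a₀ a₁ a₂ a₃ a₄ a₅ a₆) =
      MvPolynomial.C 518400 * MvPolynomial.C (2 * (a₀ * a₆ - 6 * a₁ * a₅ + 15 * a₂ * a₄ -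
        10 * a₃ * a₃)) := by
    simp only [omega, pderiv_zero_linForm, pderiv_one_linForm, pderiv_zero_quadForm,
      pderiv_one_quadForm,
    pderiv_zero_cubicForm, pderiv_one_cubicForm, pderiv_zero_quartForm, pderiv_one_quartForm,
    pderiv_zero_quintForm, pderiv_one_quintForm, pderiv_zero_sexticForm, pderiv_one_sexticForm,
    MvPolynomial.pderiv_C_mul]
    simp only [map_add, map_sub, map_mul, map_ofNat]
    ring
  rw [transvectant_eq_omega, key, ← mul_assoc, ← map_mul]
  norm_num [Nat.factorial]

end ExplicitForms

/-! ### Clebsch invariants of forms, their scaling laws, and the vanishing of `I₁₀` at a double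
root. -/

section FormInvariants

variable {k : Type*} [Field k]

/-! The Clebsch covariants and invariants of an arbitrary form `G`, meaningful for a sextic. -/

noncomputable def formI (G : MvPolynomial (Fin 2) k) : MvPolynomial (Fin 2) k :=
  transvectant 6 6 4 G G

noncomputable def formDelta (G : MvPolynomial (Fin 2) k) : MvPolynomial (Fin 2) k :=
  transvectant 4 4 2 (formI G) (formI G)

noncomputable def formY₁ (G : MvPolynomial (Fin 2) k) : MvPolynomial (Fin 2) k :=
  transvectant 6 4 4 G (formI G)

noncomputable def formY₂ (G : MvPolynomial (Fin 2) k) : MvPolynomial (Fin 2) k :=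
  transvectant 4 2 2 (formI G) (formY₁ G)

noncomputable def formY₃ (G : MvPolynomial (Fin 2) k) : MvPolynomial (Fin 2) k :=
  transvectant 4 2 2 (formI G) (formY₂ G)

noncomputable def formA (G : MvPolynomial (Fin 2) k) : k :=
  MvPolynomial.constantCoeff (transvectant 6 6 6 G G)

noncomputable def formB (G : MvPolynomial (Fin 2) k) : k :=
  MvPolynomial.constantCoeff (transvectant 4 4 4 (formI G) (formI G))

noncomputable def formC (G : MvPolynomial (Fin 2) k) : k :=
  MvPolynomial.constantCoeff (transvectant 4 4 4 (formI G) (formDelta G))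

noncomputable def formD (G : MvPolynomial (Fin 2) k) : k :=
  MvPolynomial.constantCoeff (transvectant 2 2 2 (formY₃ G) (formY₁ G))

theorem clebschA_eq_formA (f : k[X]) : clebschA f = formA (binaryForm f) := rfl

theorem clebschB_eq_formB (f : k[X]) : clebschB f = formB (binaryForm f) := rfl

theorem clebschC_eq_formC (f : k[X]) : clebschC f = formC (binaryForm f) := rfl

theorem clebschD_eq_formD (f : k[X]) : clebschD f = formD (binaryForm f) := rfl

section Equivariance

variable (e a b c d : k) (G : MvPolynomial (Fin 2) k)

theorem formI_linSubst : formI (MvPolynomial.C e * linSubst a b c d G) =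
    MvPolynomial.C (e ^ 2 * (a * d - b * c) ^ 4) * linSubst a b c d (formI G) := by
  simp only [formI, transvectant_C_mul_left, transvectant_C_mul_right, transvectant_linSubst]
  generalize a * d - b * c = δ
  simp only [map_mul, map_pow]
  ring

theorem formDelta_linSubst : formDelta (MvPolynomial.C e * linSubst a b c d G) =
    MvPolynomial.C (e ^ 4 * (a * d - b * c) ^ 10) * linSubst a b c d (formDelta G) := by
  simp only [formDelta, formI_linSubst, transvectant_C_mul_left, transvectant_C_mul_right,
    transvectant_linSubst]
  generalize a * d - b * c = δ
  simp only [map_mul, map_pow]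
  ring

theorem formY₁_linSubst : formY₁ (MvPolynomial.C e * linSubst a b c d G) =
    MvPolynomial.C (e ^ 3 * (a * d - b * c) ^ 8) * linSubst a b c d (formY₁ G) := by
  simp only [formY₁, formI_linSubst, transvectant_C_mul_left, transvectant_C_mul_right,
    transvectant_linSubst]
  generalize a * d - b * c = δ
  simp only [map_mul, map_pow]
  ring

theorem formY₂_linSubst : formY₂ (MvPolynomial.C e * linSubst a b c d G) =
    MvPolynomial.C (e ^ 5 * (a * d - b * c) ^ 14) * linSubst a b c d (formY₂ G) := by
  simp only [formY₂, formI_linSubst, formY₁_linSubst, transvectant_C_mul_left,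
    transvectant_C_mul_right, transvectant_linSubst]
  generalize a * d - b * c = δ
  simp only [map_mul, map_pow]
  ring

theorem formY₃_linSubst : formY₃ (MvPolynomial.C e * linSubst a b c d G) =
    MvPolynomial.C (e ^ 7 * (a * d - b * c) ^ 20) * linSubst a b c d (formY₃ G) := by
  simp only [formY₃, formI_linSubst, formY₂_linSubst, transvectant_C_mul_left,
    transvectant_C_mul_right, transvectant_linSubst]
  generalize a * d - b * c = δ
  simp only [map_mul, map_pow]
  ring

/-- With `r = e² (ad - bc)⁶`, the invariants `A, B, C, D` scale by `r, r², r³, r⁵`; this common `r`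
cancels in the absolute invariants. -/
theorem formA_linSubst : formA (MvPolynomial.C e * linSubst a b c d G) =
    e ^ 2 * (a * d - b * c) ^ 6 * formA G := by
  simp only [formA, transvectant_C_mul_left, transvectant_C_mul_right, transvectant_linSubst]
  generalize a * d - b * c = δ
  simp only [map_mul, map_pow, MvPolynomial.constantCoeff_C, constantCoeff_linSubst]
  ring

theorem formB_linSubst : formB (MvPolynomial.C e * linSubst a b c d G) =
    (e ^ 2 * (a * d - b * c) ^ 6) ^ 2 * formB G := by
  simp only [formB, formI_linSubst, transvectant_C_mul_left, transvectant_C_mul_right,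
    transvectant_linSubst]
  generalize a * d - b * c = δ
  simp only [map_mul, map_pow, MvPolynomial.constantCoeff_C, constantCoeff_linSubst]
  ring

theorem formC_linSubst : formC (MvPolynomial.C e * linSubst a b c d G) =
    (e ^ 2 * (a * d - b * c) ^ 6) ^ 3 * formC G := by
  simp only [formC, formI_linSubst, formDelta_linSubst, transvectant_C_mul_left,
    transvectant_C_mul_right, transvectant_linSubst]
  generalize a * d - b * c = δ
  simp only [map_mul, map_pow, MvPolynomial.constantCoeff_C, constantCoeff_linSubst]
  ring

theorem formD_linSubst : formD (MvPolynomial.C e * linSubst a b c d G) =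
    (e ^ 2 * (a * d - b * c) ^ 6) ^ 5 * formD G := by
  simp only [formD, formY₁_linSubst, formY₃_linSubst, transvectant_C_mul_left,
    transvectant_C_mul_right, transvectant_linSubst]
  generalize a * d - b * c = δ
  simp only [map_mul, map_pow, MvPolynomial.constantCoeff_C, constantCoeff_linSubst]
  ring

end Equivariance

/-- Allows a sextic form to be identified by its dehomogenisation at `Z = 1`. -/
theorem binaryForm_eq_homogenize (f : k[X]) : binaryForm f = f.homogenize 6 := by
  rw [binaryForm, homogenize, Finset.Nat.sum_antidiagonal_eq_sum_range_succ_mk]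
  refine Finset.sum_congr rfl fun i _ => ?_
  rw [MvPolynomial.monomial_eq]
  simp [Finsupp.prod_fintype, Fin.prod_univ_two, mul_assoc]

section BaseChange

variable {l : Type*} [Field l] (φ : k →+* l) (f : k[X])

theorem binaryForm_map : binaryForm (f.map φ) = MvPolynomial.map φ (binaryForm f) := by
  rw [binaryForm_eq_homogenize, binaryForm_eq_homogenize, homogenize_map]

theorem clebschA_map : clebschA (f.map φ) = φ (clebschA f) := by
  simp only [clebschA, binaryForm_map, transvectant_map, MvPolynomial.constantCoeff_map]

theorem clebschB_map : clebschB (f.map φ) = φ (clebschB f) := by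
  simp only [clebschB, covI, binaryForm_map, transvectant_map, MvPolynomial.constantCoeff_map]

theorem clebschC_map : clebschC (f.map φ) = φ (clebschC f) := by
  simp only [clebschC, covDelta, covI, binaryForm_map, transvectant_map,
    MvPolynomial.constantCoeff_map]

theorem clebschD_map : clebschD (f.map φ) = φ (clebschD f) := by
  simp only [clebschD, covY₁, covY₂, covY₃, covI, binaryForm_map, transvectant_map,
    MvPolynomial.constantCoeff_map]

theorem I₁₀_map : I₁₀ (f.map φ) = φ (I₁₀ f) := by
  simp [I₁₀, _root_.map_ofNat, clebschA_map, clebschB_map, clebschC_map, clebschD_map]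

end BaseChange

section SexticForm

variable (a b c d e f g : k)

theorem isHomogeneous_sexticForm : (sexticForm a b c d e f g).IsHomogeneous 6 := by
  have h : ∀ (r : k) (i j : ℕ), i + j = 6 → (MvPolynomial.C r * MvPolynomial.X 0 ^ i *
      MvPolynomial.X 1 ^ j : MvPolynomial (Fin 2) k).IsHomogeneous 6 := by
    intro r i j hij
    exact hij ▸ (MvPolynomial.isHomogeneous_C_mul_X_pow r 0 i).mul
      (MvPolynomial.isHomogeneous_X_pow 1 j)
  have h₁ := ((((((h a 6 0 rfl).add (h (6 * b) 5 1 rfl)).add (h (15 * c) 4 2 rfl)).add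
    (h (20 * d) 3 3 rfl)).add (h (15 * e) 2 4 rfl)).add (h (6 * f) 1 5 rfl)).add (h g 0 6 rfl)
  convert h₁ using 1
  simp [sexticForm, _root_.map_ofNat]

theorem isHomogeneous_linSubst {G : MvPolynomial (Fin 2) k} {n : ℕ} (hG : G.IsHomogeneous n) :
    (linSubst a b c d G).IsHomogeneous n := by
  have := hG.aeval (S := k) (τ := Fin 2) (n := 1)
    ![MvPolynomial.C a * MvPolynomial.X 0 + MvPolynomial.C b * MvPolynomial.X 1,
      MvPolynomial.C c * MvPolynomial.X 0 + MvPolynomial.C d * MvPolynomial.X 1] (by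
    intro i
    fin_cases i <;> exact (MvPolynomial.isHomogeneous_C_mul_X _ _).add
      (MvPolynomial.isHomogeneous_C_mul_X _ _))
  rwa [one_mul] at this

theorem aeval_linSubst (G : MvPolynomial (Fin 2) k) :
    MvPolynomial.aeval ![X, (1 : k[X])] (linSubst a b c d G) =
      MvPolynomial.aeval ![C a * X + C b, C c * X + C d] G := by
  rw [linSubst, ← AlgHom.comp_apply]
  congr 1
  ext i : 1
  fin_cases i <;> simp [Polynomial.algebraMap_eq]

theorem aeval_sexticForm (p q : k[X]) : MvPolynomial.aeval ![p, q] (sexticForm a b c d e f g) =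
    C a * p ^ 6 + 6 * C b * p ^ 5 * q + 15 * C c * p ^ 4 * q ^ 2 + 20 * C d * p ^ 3 * q ^ 3 +
      15 * C e * p ^ 2 * q ^ 4 + 6 * C f * p * q ^ 5 + C g * q ^ 6 := by
  simp [sexticForm, Polynomial.algebraMap_eq]

end SexticForm

section CharZero

variable [CharZero k]

/-- The invariants of a sextic form, in terms of its covariants `i` and `y₁`. -/
theorem formBCD_of_eq {G : MvPolynomial (Fin 2) k} {i₀ i₁ i₂ i₃ i₄ p q r : k}
    (hI : formI G = quartForm i₀ i₁ i₂ i₃ i₄) (hY : formY₁ G = quadForm p q r) :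
    formB G = 2 * (i₀ * i₄ - 4 * i₁ * i₃ + 3 * i₂ ^ 2) ∧
    formC G = 6 * (i₀ * i₂ * i₄ + 2 * i₁ * i₂ * i₃ - i₀ * i₃ ^ 2 - i₁ ^ 2 * i₄ - i₂ ^ 3) ∧
    formY₂ G = quadForm (i₀ * r - 2 * i₁ * q + i₂ * p) (i₁ * r - 2 * i₂ * q + i₃ * p)
      (i₂ * r - 2 * i₃ * q + i₄ * p) ∧
    formD G = (i₀ * r - 2 * i₁ * q + i₂ * p) * (i₂ * r - 2 * i₃ * q + i₄ * p) * 2 -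
      2 * (i₁ * r - 2 * i₂ * q + i₃ * p) ^ 2 := by
  have hΔ := transvectant_quartForm_two_self i₀ i₁ i₂ i₃ i₄
    ((i₀ * i₄ + 2 * i₁ * i₃ - 3 * i₂ * i₂) / 3) (by field_simp)
  have hY₂ : formY₂ G = quadForm (i₀ * r - 2 * i₁ * q + i₂ * p) (i₁ * r - 2 * i₂ * q + i₃ * p)
      (i₂ * r - 2 * i₃ * q + i₄ * p) := by
    rw [formY₂, hI, hY, transvectant_quartForm_quadForm_two]
  refine ⟨?_, ?_, hY₂, ?_⟩
  · rw [formB, hI, transvectant_quartForm_four, MvPolynomial.constantCoeff_C]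
    ring
  · rw [formC, formDelta, hI, hΔ, transvectant_quartForm_four, MvPolynomial.constantCoeff_C]
    ring
  · rw [formD, formY₃, hY₂, hI, hY, transvectant_quartForm_quadForm_two, transvectant_quadForm_two,
      MvPolynomial.constantCoeff_C]
    ring

theorem formI_sexticForm (a₀ a₁ a₂ a₃ a₄ a₅ a₆ : k) : formI (sexticForm a₀ a₁ a₂ a₃ a₄ a₅ a₆) =
    quartForm (2 * (a₀ * a₄ - 4 * a₁ * a₃ + 3 * a₂ * a₂)) (a₀ * a₅ - 3 * a₁ * a₄ + 2 * a₂ * a₃)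
      ((a₀ * a₆ - 9 * a₂ * a₄ + 8 * a₃ * a₃) / 3) (a₁ * a₆ - 3 * a₂ * a₅ + 2 * a₃ * a₄)
      (2 * (a₂ * a₆ - 4 * a₃ * a₅ + 3 * a₄ * a₄)) :=
  transvectant_sexticForm_four_self _ _ _ _ _ _ _ _ (by field_simp)

theorem formA_sexticForm (a₀ a₁ a₂ a₃ a₄ a₅ a₆ : k) : formA (sexticForm a₀ a₁ a₂ a₃ a₄ a₅ a₆) =
    2 * (a₀ * a₆ - 6 * a₁ * a₅ + 15 * a₂ * a₄ - 10 * a₃ * a₃) := by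
  rw [formA, transvectant_sexticForm_six_self, MvPolynomial.constantCoeff_C]

/-- `I₁₀` as a function of the Clebsch invariants. -/
def igusaTen (A B C D : k) : k :=
  -62208 * A ^ 5 + 972000 * A ^ 3 * B + 1620000 * A ^ 2 * C - 3037500 * A * B ^ 2
    - 6075000 * B * C - 4556250 * D

/-- The form is divisible by `X²`, hence has a double root at `X = 0`; the discriminant vanishes
there as a polynomial identity. -/
theorem igusaTen_sexticForm_eq_zero (a b c d e : k) :
    igusaTen (formA (sexticForm a b c d e 0 0)) (formB (sexticForm a b c d e 0 0))
      (formC (sexticForm a b c d e 0 0)) (formD (sexticForm a b c d e 0 0)) = 0 := by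
  have hI := formI_sexticForm a b c d e 0 0
  have hY := congrArg (transvectant 6 4 4 (sexticForm a b c d e 0 0)) hI
  rw [transvectant_sexticForm_quartForm_four] at hY
  obtain ⟨hB, hC, -, hD⟩ := formBCD_of_eq hI hY
  rw [formA_sexticForm, hB, hC, hD, igusaTen]
  field_simp
  ring

/-- A common root `r` of `f` and `f'` in an algebraic closure is translated to `0`, which changes no
invariant since the substitution has determinant one; there `igusaTen_sexticForm_eq_zero` applies.
Only this implication is needed, not the full identification of `I₁₀` with the discriminant. -/
theorem separable_of_I₁₀_ne_zero {f : k[X]} (hf : f.natDegree ≤ 6) (h : I₁₀ f ≠ 0) :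
    f.Separable := by
  contrapose! h
  let E := AlgebraicClosure k
  have : CharZero E := charZero_of_injective_algebraMap (algebraMap k E).injective
  replace h := (isCoprime_iff_aeval_ne_zero_of_isAlgClosed k E f (derivative f)).not.mp h
  push Not at h
  obtain ⟨r, h₀, h₁⟩ := h
  apply (algebraMap k E).injective
  rw [← I₁₀_map, map_zero]
  set F := f.map (algebraMap k E)
  have hF : F.natDegree ≤ 6 := natDegree_map_le.trans hf
  have hF₀ : (taylor r F).coeff 0 = 0 := by
    rw [taylor_coeff_zero, eval_map_algebraMap, h₀]
  have hF₁ : (taylor r F).coeff 1 = 0 := by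
    rw [taylor_coeff_one, derivative_map, eval_map_algebraMap, h₁]
  set T := taylor r F
  have hform : binaryForm F = MvPolynomial.C 1 * linSubst 1 (-r) 0 1 (sexticForm (T.coeff 6)
      (T.coeff 5 / 6) (T.coeff 4 / 15) (T.coeff 3 / 20) (T.coeff 2 / 15) 0 0) := by
    rw [binaryForm_eq_homogenize, map_one, one_mul]
    refine homogenize_eq_of_isHomogeneous
      (isHomogeneous_linSubst _ _ _ _ (isHomogeneous_sexticForm _ _ _ _ _ _ _)) ?_
    rw [aeval_linSubst, aeval_sexticForm]
    conv_rhs => rw [← sum_taylor_eq F r, Polynomial.sum_over_range' _ (by simp) 7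
      (by rw [natDegree_taylor]; omega)]
    have hC : ∀ (n : ℕ) [n.AtLeastTwo] (x : E),
        (ofNat(n) : E[X]) * C (x / ofNat(n)) = C x := by
      intro n _ x
      rw [← C_ofNat, ← C_mul, mul_div_cancel₀ _ (OfNat.ofNat_ne_zero n)]
    simp only [Finset.sum_range_succ, Finset.sum_range_zero]
    simp only [T] at hF₀ hF₁ ⊢
    simp only [hC, hF₀, hF₁, map_zero, map_one, map_neg]
    ring
  have := igusaTen_sexticForm_eq_zero (T.coeff 6)
      (T.coeff 5 / 6) (T.coeff 4 / 15) (T.coeff 3 / 20) (T.coeff 2 / 15)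
  rw [I₁₀, clebschA_eq_formA, clebschB_eq_formB, clebschC_eq_formC, clebschD_eq_formD, hform,
    formA_linSubst, formB_linSubst, formC_linSubst, formD_linSubst]
  simpa [igusaTen] using this

end CharZero

end FormInvariants

/-! ### A sextic with diagonal covariant `i` and prescribed Clebsch invariants. -/

section Diagonal

/-! The moments `sₙ`, multiplied by `18`: the Hankel matrix of the `sₙ` is the Gram matrix
`((yᵢ yⱼ)₂)` of the covariants `y₁, y₂, y₃`. -/

variable {R : Type*} [CommRing R]

def gram₀ (A B C : R) : R := 6 * A * B + 36 * C

def gram₁ (A B C : R) : R := 12 * B ^ 2 + 12 * A * C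

def gram₂ (D : R) : R := 18 * D

def gram₃ (A B C : R) : R := 6 * B ^ 3 + 8 * A * B * C + 12 * C ^ 2

def gram₄ (A B C D : R) : R := 4 * B ^ 2 * C + 4 * A * C ^ 2 + 9 * B * D

variable {k : Type*} [Field k]

/-- A sextic form whose covariant `i` is the diagonal quartic `α X⁴ + 6 β X² Z² + α Z⁴`. -/
noncomputable def diagForm (α β v₁ v₂ v₃ : k) : MvPolynomial (Fin 2) k :=
  sexticForm
    ((v₁ * (4 / (2 * α) + 1 / (α + 3 * β)) - v₂ * (1 / (3 * β - α) - 4 / (2 * α))) / 4)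
    (v₃ * (1 / (α + 3 * β) - 1 / (3 * β - α)) / 4)
    ((v₁ / (α + 3 * β) + v₂ / (3 * β - α)) / 4)
    (v₃ * (1 / (α + 3 * β) + 1 / (3 * β - α)) / 4)
    ((v₁ / (α + 3 * β) - v₂ / (3 * β - α)) / 4)
    (v₃ * (1 / (α + 3 * β) - 1 / (3 * β - α)) / 4)
    ((v₁ * (4 / (2 * α) + 1 / (α + 3 * β)) + v₂ * (1 / (3 * β - α) - 4 / (2 * α))) / 4)

variable [CharZero k] {α β v₁ v₂ v₃ A B C D : k}

/-- The relations between the parameters of `diagForm` and its Clebsch invariants. -/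
structure DiagRelations (α β v₁ v₂ v₃ A B C D : k) : Prop where
  hα : α ≠ 0
  hp : α + 3 * β ≠ 0
  hm : 3 * β - α ≠ 0
  hB : B = 2 * α ^ 2 + 6 * β ^ 2
  hC : C = 6 * β * (α ^ 2 - β ^ 2)
  h₁ : v₁ ^ 2 = (gram₂ D + (α + β) * gram₁ A B C - 2 * β * (β - α) * gram₀ A B C) /
    (72 * α * (α + 3 * β))
  h₂ : v₂ ^ 2 = (gram₂ D + (β - α) * gram₁ A B C - 2 * β * (β + α) * gram₀ A B C) /
    (72 * α * (3 * β - α))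
  h₃ : v₃ ^ 2 = (gram₂ D - 2 * β * gram₁ A B C + (β ^ 2 - α ^ 2) * gram₀ A B C) /
    (- 36 * (α + 3 * β) * (3 * β - α))

/-- On quadratics, `(i ·)₂` has eigenvectors `X² + Z²`, `X² - Z²`, `2XZ` with eigenvalues `α + β`,
`β - α`, `-2β`. The hypotheses `hα, hp, hm` say that these are distinct; `h₁, h₂, h₃` solve the
Vandermonde system giving the squared coordinates of `y₁` from the first three moments. -/
theorem formI_diagForm (h : DiagRelations α β v₁ v₂ v₃ A B C D) :
    formI (diagForm α β v₁ v₂ v₃) = quartForm α 0 β 0 α := by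
  obtain ⟨hα, hp, hm, rfl, rfl, h₁, h₂, h₃⟩ := h
  simp only [gram₀, gram₁, gram₂] at h₁ h₂ h₃
  rw [diagForm, formI_sexticForm]
  -- `p, q, r` are the inverse differences of the eigenvalues. The multiplier of each relation below
  -- is the coefficient of the corresponding `vᵢ²`; the terms in `v₁v₂` cancel because `pq + qr =
  -- pr`.
  set p := 1 / (2 * α) with hpd
  set q := 1 / (α + 3 * β) with hqd
  set r := 1 / (3 * β - α) with hrd
  congr 1
  · linear_combination (norm := (simp only [hpd, hqd, hrd]; field_simp; ring))
      q * (p + q) / 2 * h₁ + r * (r - p) / 2 * h₂ - (q ^ 2 - r ^ 2) / 2 * h₃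
  · simp only [hqd, hrd]; field_simp; ring
  · linear_combination (norm := (simp only [hpd, hqd, hrd]; field_simp; ring))
      ((4 * p + q) ^ 2 - 9 * q ^ 2) / 48 * h₁ + (9 * r ^ 2 - (r - 4 * p) ^ 2) / 48 * h₂ +
        (q + r) ^ 2 / 6 * h₃
  · simp only [hqd, hrd]; field_simp; ring
  · linear_combination (norm := (simp only [hpd, hqd, hrd]; field_simp; ring))
      q * (p + q) / 2 * h₁ + r * (r - p) / 2 * h₂ - (q ^ 2 - r ^ 2) / 2 * h₃

theorem formA_diagForm (h : DiagRelations α β v₁ v₂ v₃ A B C D) :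
    formA (diagForm α β v₁ v₂ v₃) = A := by
  obtain ⟨hα, hp, hm, rfl, rfl, h₁, h₂, h₃⟩ := h
  simp only [gram₀, gram₁, gram₂] at h₁ h₂ h₃
  rw [diagForm, formA_sexticForm]
  set p := 1 / (2 * α) with hpd
  set q := 1 / (α + 3 * β) with hqd
  set r := 1 / (3 * β - α) with hrd
  linear_combination (norm := (simp only [hpd, hqd, hrd]; field_simp; ring))
    ((4 * p + q) ^ 2 + 15 * q ^ 2) / 8 * h₁ - ((r - 4 * p) ^ 2 + 15 * r ^ 2) / 8 * h₂ -
      (6 * (q - r) ^ 2 + 10 * (q + r) ^ 2) / 8 * h₃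

theorem formY₁_diagForm (h : DiagRelations α β v₁ v₂ v₃ A B C D) :
    formY₁ (diagForm α β v₁ v₂ v₃) = quadForm (v₁ + v₂) v₃ (v₁ - v₂) := by
  rw [formY₁, formI_diagForm h, diagForm, transvectant_sexticForm_quartForm_four]
  obtain ⟨hα, hp, hm, -⟩ := h
  congr 1 <;> field_simp <;> ring

theorem formBCD_diagForm (h : DiagRelations α β v₁ v₂ v₃ A B C D) :
    formB (diagForm α β v₁ v₂ v₃) = B ∧ formC (diagForm α β v₁ v₂ v₃) = C ∧
      formD (diagForm α β v₁ v₂ v₃) = D := by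
  obtain ⟨hB, hC, -, hD⟩ := formBCD_of_eq (formI_diagForm h) (formY₁_diagForm h)
  rw [hB, hC, hD]
  obtain ⟨hα, hp, hm, rfl, rfl, h₁, h₂, h₃⟩ := h
  simp only [gram₀, gram₁, gram₂] at h₁ h₂ h₃
  refine ⟨by ring, by ring, ?_⟩
  have hW : 72 * α * (α + 3 * β) * (3 * β - α) ≠ 0 := by simp [hα, hp, hm]
  rw [eq_div_iff (by simp [hα, hp])] at h₁
  rw [eq_div_iff (by simp [hα, hm])] at h₂
  rw [eq_div_iff (by simp [hp, hm])] at h₃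
  refine mul_left_cancel₀ hW ?_
  linear_combination 2 * (α + β) ^ 2 * (3 * β - α) * h₁ - 2 * (β - α) ^ 2 * (α + 3 * β) * h₂ +
    16 * β ^ 2 * α * h₃

end Diagonal

/-! ### Mestre's cubic in terms of the Clebsch invariants. -/

section MestreCubic

variable {R : Type*} [CommRing R]

/-! The values `324 (F, yᵢ yⱼ yₖ)₆` and the corresponding cubic form (Mestre's cubic). -/

def mestre₁₁₁ (A B C D : R) : R :=
  72 * A ^ 2 * C - 432 * B * C + 648 * D

def mestre₁₁₂ (A B C D : R) : R :=
  72 * B ^ 3 + 144 * A * B * C + 432 * C ^ 2 + 108 * A * D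

def mestre₁₁₃ (A B C D : R) : R :=
  36 * A * B ^ 3 + 48 * A ^ 2 * B * C + 144 * B ^ 2 * C + 216 * A * C ^ 2 + 108 * B * D

def mestre₁₂₂ (A B C D : R) : R :=
  36 * A * B ^ 3 + 48 * A ^ 2 * B * C + 144 * B ^ 2 * C + 216 * A * C ^ 2 + 108 * B * D

def mestre₁₂₃ (A B C D : R) : R :=
  36 * B ^ 4 + 72 * A * B ^ 2 * C + 24 * A ^ 2 * C ^ 2 + 72 * B * C ^ 2 + 54 * A * B * D +
    216 * C * D

def mestre₁₃₃ (A B C D : R) : R :=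
  18 * A * B ^ 4 + 24 * A ^ 2 * B ^ 2 * C + 96 * B ^ 3 * C + 156 * A * B * C ^ 2 + 144 * C ^ 3 +
    54 * B ^ 2 * D + 36 * A * C * D

def mestre₂₂₂ (A B C D : R) : R :=
  108 * B ^ 4 + 216 * A * B ^ 2 * C + 96 * A ^ 2 * C ^ 2 + 72 * B * C ^ 2 - 108 * C * D

def mestre₂₂₃ (A B C D : R) : R :=
  -12 * B ^ 3 * C - 24 * A * B * C ^ 2 - 72 * C ^ 3 + 162 * B ^ 2 * D + 144 * A * C * D

def mestre₂₃₃ (A B C D : R) : R :=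
  18 * B ^ 5 + 36 * A * B ^ 3 * C + 16 * A ^ 2 * B * C ^ 2 + 12 * B ^ 2 * C ^ 2 - 18 * B * C * D +
    162 * D ^ 2

def mestre₃₃₃ (A B C D : R) : R :=
  -18 * B ^ 4 * C - 36 * A * B ^ 2 * C ^ 2 - 16 * A ^ 2 * C ^ 3 - 12 * B * C ^ 3 + 81 * B ^ 3 * D +
    108 * A * B * C * D + 180 * C ^ 2 * D

def mestreCubic (A B C D x y z : R) : R :=
  mestre₁₁₁ A B C D * x ^ 3 +
    3 * mestre₁₁₂ A B C D * x ^ 2 * y +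
    3 * mestre₁₁₃ A B C D * x ^ 2 * z +
    3 * mestre₁₂₂ A B C D * x * y ^ 2 +
    6 * mestre₁₂₃ A B C D * x * y * z +
    3 * mestre₁₃₃ A B C D * x * z ^ 2 +
    mestre₂₂₂ A B C D * y ^ 3 +
    3 * mestre₂₂₃ A B C D * y ^ 2 * z +
    3 * mestre₂₃₃ A B C D * y * z ^ 2 +
    mestre₃₃₃ A B C D * z ^ 3

variable {k : Type*} [Field k] [CharZero k]

/-- In the eigenbasis, `x y₁ + y y₂ + z y₃` has coordinates `vᵢ lᵢ`, and `wᵢ` is `vᵢ²` times the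
norm `2, -2, -2` of the basis vector. The left side is unchanged by simultaneous permutations of
eigenvalues, `wᵢ` and `lᵢ`, which is why it can be written in `A, B, C, D` alone. -/
theorem mestreCubic_eq (α β A D x y z : k) (hα : α ≠ 0) (hu : α + 3 * β ≠ 0) (hm : 3 * β - α ≠ 0)
    (B C w₁ w₂ w₃ l₁ l₂ l₃ : k)
    (hB : B = 2 * α ^ 2 + 6 * β ^ 2) (hC : C = 6 * β * (α ^ 2 - β ^ 2))
    (h₁ : w₁ = (gram₂ D + (α + β) * gram₁ A B C - 2 * β * (β - α) * gram₀ A B C) /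
      (36 * α * (α + 3 * β)))
    (h₂ : w₂ = (gram₂ D + (β - α) * gram₁ A B C - 2 * β * (β + α) * gram₀ A B C) /
      (-36 * α * (3 * β - α)))
    (h₃ : w₃ = (gram₂ D - 2 * β * gram₁ A B C + (β ^ 2 - α ^ 2) * gram₀ A B C) /
      (18 * (α + 3 * β) * (3 * β - α)))
    (hl₁ : l₁ = x + (α + β) * y + (α + β) ^ 2 * z)
    (hl₂ : l₂ = x + (β - α) * y + (β - α) ^ 2 * z)
    (hl₃ : l₃ = x - 2 * β * y + 4 * β ^ 2 * z) :
    324 * ((3 * w₁ * w₂ * l₁ * l₂ * (l₁ - l₂) + w₁ ^ 2 * l₁ ^ 3 - w₂ ^ 2 * l₂ ^ 3) / (4 * α) +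
      (3 * w₁ * w₃ * l₁ * l₃ * (l₁ - l₃) + w₁ ^ 2 * l₁ ^ 3 - w₃ ^ 2 * l₃ ^ 3) /
        (2 * (α + 3 * β)) +
      (3 * w₂ * w₃ * l₂ * l₃ * (l₂ - l₃) + w₂ ^ 2 * l₂ ^ 3 - w₃ ^ 2 * l₃ ^ 3) /
        (2 * (3 * β - α))) = mestreCubic A B C D x y z := by
  simp only [gram₀, gram₁, gram₂] at h₁ h₂ h₃
  subst hB hC h₁ h₂ h₃ hl₁ hl₂ hl₃
  simp only [mestreCubic, mestre₁₁₁, mestre₁₁₂, mestre₁₁₃, mestre₁₂₂, mestre₁₂₃, mestre₁₃₃,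
    mestre₂₂₂, mestre₂₂₃, mestre₂₃₃, mestre₃₃₃]
  set_option maxHeartbeats 4000000 in
  field_simp
  set_option maxHeartbeats 4000000 in
  ring

end MestreCubic

/-! ### The cubic on squares of linear forms. -/

section DiagonalCubic

variable {k : Type*} [Field k] [CharZero k] {α β v₁ v₂ v₃ A B C D : k}

/-- The moments of the eigenvalues of `(i ·)₂`, weighted by the coordinates of `y₁`. -/
theorem DiagRelations.moments (h : DiagRelations α β v₁ v₂ v₃ A B C D) :
    gram₀ A B C = 36 * (v₁ ^ 2 - v₂ ^ 2 - v₃ ^ 2) ∧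
    gram₁ A B C = 36 * (v₁ ^ 2 * (α + β) - v₂ ^ 2 * (β - α) - v₃ ^ 2 * (-2 * β)) ∧
    gram₂ D = 36 * (v₁ ^ 2 * (α + β) ^ 2 - v₂ ^ 2 * (β - α) ^ 2 - v₃ ^ 2 * (-2 * β) ^ 2) ∧
    gram₃ A B C = 36 * (v₁ ^ 2 * (α + β) ^ 3 - v₂ ^ 2 * (β - α) ^ 3 - v₃ ^ 2 * (-2 * β) ^ 3) ∧
    gram₄ A B C D = 36 * (v₁ ^ 2 * (α + β) ^ 4 - v₂ ^ 2 * (β - α) ^ 4 -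
      v₃ ^ 2 * (-2 * β) ^ 4) := by
  obtain ⟨hα, hp, hm, hB, hC, h₁, h₂, h₃⟩ := h
  have hW : 2 * α * (α + 3 * β) * (3 * β - α) ≠ 0 := by simp [hα, hp, hm]
  rw [eq_div_iff (by simp [hα, hp])] at h₁
  rw [eq_div_iff (by simp [hα, hm])] at h₂
  rw [eq_div_iff (by simp [hp, hm])] at h₃
  have m₀ : gram₀ A B C = 36 * (v₁ ^ 2 - v₂ ^ 2 - v₃ ^ 2) := by
    refine mul_left_cancel₀ hW ?_
    linear_combination (-(3 * β - α)) * h₁ + (α + 3 * β) * h₂ - 2 * α * h₃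
  have m₁ : gram₁ A B C =
      36 * (v₁ ^ 2 * (α + β) - v₂ ^ 2 * (β - α) - v₃ ^ 2 * (-2 * β)) := by
    refine mul_left_cancel₀ hW ?_
    linear_combination (-(3 * β - α) * (α + β)) * h₁ + (α + 3 * β) * (β - α) * h₂ -
      2 * α * (-2 * β) * h₃
  have m₂ : gram₂ D =
      36 * (v₁ ^ 2 * (α + β) ^ 2 - v₂ ^ 2 * (β - α) ^ 2 - v₃ ^ 2 * (-2 * β) ^ 2) := by
    refine mul_left_cancel₀ hW ?_
    linear_combination (-(3 * β - α) * (α + β) ^ 2) * h₁ + (α + 3 * β) * (β - α) ^ 2 * h₂ -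
      2 * α * (-2 * β) ^ 2 * h₃
  -- Cayley–Hamilton: the eigenvalues have sum zero and are the roots of `t³ - (B/2) t - C/3`, so
  -- the higher moments follow from the first three.
  have r₃ : gram₃ A B C = B / 2 * gram₁ A B C + C / 3 * gram₀ A B C := by
    simp only [gram₀, gram₁, gram₃]; ring
  have r₄ : gram₄ A B C D = B / 2 * gram₂ D + C / 3 * gram₁ A B C := by
    simp only [gram₁, gram₂, gram₄]; ring
  refine ⟨m₀, m₁, m₂, ?_, ?_⟩
  · rw [r₃, m₀, m₁, hB, hC]; ring
  · rw [r₄, m₁, m₂, hB, hC]; ring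

/-- The value of `diagForm` in terms of the square `(P X + Q Z)²` of a linear form, written in the
eigenbasis `X² + Z², X² - Z², 2 X Z`. -/
theorem aeval_diagForm_of_sq (hα : α ≠ 0) (hp : α + 3 * β ≠ 0) (hm : 3 * β - α ≠ 0)
    {P Q l₁ l₂ l₃ : k} (h₁ : P ^ 2 = v₁ * l₁ + v₂ * l₂) (h₂ : P * Q = v₃ * l₃)
    (h₃ : Q ^ 2 = v₁ * l₁ - v₂ * l₂) :
    MvPolynomial.aeval ![Q, -P] (diagForm α β v₁ v₂ v₃) =
      (3 * (2 * v₁ ^ 2) * (-2 * v₂ ^ 2) * l₁ * l₂ * (l₁ - l₂) + (2 * v₁ ^ 2) ^ 2 * l₁ ^ 3 -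
          (-2 * v₂ ^ 2) ^ 2 * l₂ ^ 3) / (4 * α) +
      (3 * (2 * v₁ ^ 2) * (-2 * v₃ ^ 2) * l₁ * l₃ * (l₁ - l₃) + (2 * v₁ ^ 2) ^ 2 * l₁ ^ 3 -
          (-2 * v₃ ^ 2) ^ 2 * l₃ ^ 3) / (2 * (α + 3 * β)) +
      (3 * (-2 * v₂ ^ 2) * (-2 * v₃ ^ 2) * l₂ * l₃ * (l₂ - l₃) + (-2 * v₂ ^ 2) ^ 2 * l₂ ^ 3 -
          (-2 * v₃ ^ 2) ^ 2 * l₃ ^ 3) / (2 * (3 * β - α)) := by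
  have e₁ : Q ^ 6 = (v₁ * l₁ - v₂ * l₂) ^ 3 := by rw [← h₃]; ring
  have e₂ : Q ^ 5 * P = (v₁ * l₁ - v₂ * l₂) ^ 2 * (v₃ * l₃) := by rw [← h₃, ← h₂]; ring
  -- A cubic in `P², PQ, Q²` is determined only modulo `P²Q² = (PQ)²`. The splittings `15 = 3 + 12`
  -- and `20 = 8 + 12` count the ways of distributing the letters over three pairs, that is, they
  -- pick the polarised representative.
  have e₃ : 15 * (Q ^ 4 * P ^ 2) = 3 * (v₁ * l₁ - v₂ * l₂) ^ 2 * (v₁ * l₁ + v₂ * l₂) +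
      12 * (v₁ * l₁ - v₂ * l₂) * (v₃ * l₃) ^ 2 := by rw [← h₃, ← h₂, ← h₁]; ring
  have e₄ : 20 * (Q ^ 3 * P ^ 3) = 8 * (v₃ * l₃) ^ 3 +
      12 * (v₁ * l₁ + v₂ * l₂) * (v₃ * l₃) * (v₁ * l₁ - v₂ * l₂) := by
    rw [← h₃, ← h₂, ← h₁]; ring
  have e₅ : 15 * (Q ^ 2 * P ^ 4) = 3 * (v₁ * l₁ + v₂ * l₂) ^ 2 * (v₁ * l₁ - v₂ * l₂) +
      12 * (v₁ * l₁ + v₂ * l₂) * (v₃ * l₃) ^ 2 := by rw [← h₃, ← h₂, ← h₁]; ring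
  have e₆ : Q * P ^ 5 = (v₁ * l₁ + v₂ * l₂) ^ 2 * (v₃ * l₃) := by rw [← h₁, ← h₂]; ring
  have e₇ : P ^ 6 = (v₁ * l₁ + v₂ * l₂) ^ 3 := by rw [← h₁]; ring
  have key : ∀ a b c d e f g : k, MvPolynomial.aeval ![Q, -P] (sexticForm a b c d e f g) =
      a * Q ^ 6 - 6 * b * (Q ^ 5 * P) + c * (15 * (Q ^ 4 * P ^ 2)) - d * (20 * (Q ^ 3 * P ^ 3)) +
        e * (15 * (Q ^ 2 * P ^ 4)) - 6 * f * (Q * P ^ 5) + g * P ^ 6 := by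
    intro a b c d e f g
    simp [sexticForm]
    ring
  rw [diagForm, key, e₁, e₂, e₃, e₄, e₅, e₆, e₇]
  field_simp
  ring

/-- The heart of the construction: the hypotheses say that `x y₁ + y y₂ + z y₃ = (PX + QZ)²`, and
the sixth transvectant of `F` with `(PX + QZ)⁶` is the value `F(Q, -P)`. -/
theorem mestreCubic_eq_aeval_diagForm (h : DiagRelations α β v₁ v₂ v₃ A B C D) {P Q x y z : k}
    (h₁ : P ^ 2 = v₁ * (x + (α + β) * y + (α + β) ^ 2 * z) +
      v₂ * (x + (β - α) * y + (β - α) ^ 2 * z))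
    (h₂ : P * Q = v₃ * (x - 2 * β * y + 4 * β ^ 2 * z))
    (h₃ : Q ^ 2 = v₁ * (x + (α + β) * y + (α + β) ^ 2 * z) -
      v₂ * (x + (β - α) * y + (β - α) ^ 2 * z)) :
    mestreCubic A B C D x y z =
      324 * MvPolynomial.aeval ![Q, -P] (diagForm α β v₁ v₂ v₃) := by
  rw [aeval_diagForm_of_sq h.hα h.hp h.hm h₁ h₂ h₃]
  refine (mestreCubic_eq α β A D x y z h.hα h.hp h.hm B C _ _ _ _ _ _ h.hB h.hC ?_ ?_ ?_
    rfl rfl rfl).symm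
  · have h0 := h.hα; have h1 := h.hp
    rw [h.h₁]; field_simp; ring
  · have h0 := h.hα; have h1 := h.hm
    rw [h.h₂]; field_simp; ring
  · have h0 := h.hp; have h1 := h.hm
    rw [h.h₃]; field_simp; ring

end DiagonalCubic

/-! ### Square roots of parametrised isotropic quadratics. -/

section Parametrisation

theorem exists_sq_of_isotropic {E : Type*} [Field E] [IsAlgClosed E] {a₀ a₁ a₂ : E}
    (h : a₀ * a₂ = a₁ ^ 2) : ∃ p q, a₀ = p ^ 2 ∧ a₁ = p * q ∧ a₂ = q ^ 2 := by
  obtain ⟨p, hp⟩ := IsAlgClosed.exists_pow_nat_eq a₀ (n := 2) (by norm_num)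
  obtain ⟨q, hq⟩ := IsAlgClosed.exists_pow_nat_eq a₂ (n := 2) (by norm_num)
  have : a₁ ^ 2 = (p * q) ^ 2 := by rw [← h, ← hp, ← hq]; ring
  rcases sq_eq_sq_iff_eq_or_eq_neg.mp this with h' | h'
  · exact ⟨p, q, hp.symm, h', hq.symm⟩
  · exact ⟨p, -q, hp.symm, by rw [h']; ring, by rw [← hq]; ring⟩

/-- A quadratically parametrised isotropic vector of `X₀ X₂ - X₁²` is the square of a linear one. -/
theorem exists_linear_sqrt {E : Type*} [Field E] [IsAlgClosed E] [CharZero E]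
    {a₀ a₁ a₂ b₀ b₁ b₂ c₀ c₁ c₂ : E}
    (ha : a₀ * a₂ = a₁ ^ 2) (hc : c₀ * c₂ = c₁ ^ 2) (hab : a₀ * b₂ + a₂ * b₀ = 2 * a₁ * b₁)
    (hbc : b₀ * c₂ + b₂ * c₀ = 2 * b₁ * c₁)
    (hac : a₀ * c₂ + a₂ * c₀ - 2 * a₁ * c₁ + b₀ * b₂ - b₁ ^ 2 = 0)
    (h : a₀ * c₂ + a₂ * c₀ - 2 * a₁ * c₁ ≠ 0) :
    ∃ p q p' q', p * q' - p' * q ≠ 0 ∧ a₀ = p ^ 2 ∧ a₁ = p * q ∧ a₂ = q ^ 2 ∧ c₀ = p' ^ 2 ∧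
      c₁ = p' * q' ∧ c₂ = q' ^ 2 ∧ b₀ = 2 * (p * p') ∧ b₁ = p * q' + p' * q ∧
        b₂ = 2 * (q * q') := by
  obtain ⟨p, q, rfl, rfl, rfl⟩ := exists_sq_of_isotropic ha
  obtain ⟨p', q', rfl, rfl, rfl⟩ := exists_sq_of_isotropic hc
  have hd : p * q' - p' * q ≠ 0 := fun h0 => h (by linear_combination (p * q' - p' * q) * h0)
  set d := p * q' - p' * q with hdd
  -- Since `b` is orthogonal to `a` and `c`, it is a multiple `κ` of `(2pp', pq' + p'q, 2qq')`; `κ`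
  -- is read off by pairing with that vector. Then `hac` forces `κ² = 1`, and the sign is absorbed
  -- into `(p', q')`.
  obtain ⟨κ, hκ⟩ : ∃ κ, κ * d ^ 2 = -(b₀ * q * q' + b₂ * p * p' - b₁ * (p * q' + p' * q)) :=
    ⟨_ / d ^ 2, div_mul_cancel₀ _ (pow_ne_zero 2 hd)⟩
  have hd2 : d ^ 2 ≠ 0 := pow_ne_zero 2 hd
  have e₀ : b₀ = κ * (2 * (p * p')) := by
    refine mul_left_cancel₀ hd2 ?_
    linear_combination (-2 * p * p') * hκ + (d * b₀ + (p * q' - p' * q) * b₀) * hdd +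
      p' ^ 2 * hab + p ^ 2 * hbc
  have e₁ : b₁ = κ * (p * q' + p' * q) := by
    refine mul_left_cancel₀ hd2 ?_
    linear_combination (-(p * q' + p' * q)) * hκ + (d * b₁ + (p * q' - p' * q) * b₁) * hdd +
      p' * q' * hab + p * q * hbc
  have e₂ : b₂ = κ * (2 * (q * q')) := by
    refine mul_left_cancel₀ hd2 ?_
    linear_combination (-2 * q * q') * hκ + (d * b₂ + (p * q' - p' * q) * b₂) * hdd +
      q' ^ 2 * hab + q ^ 2 * hbc
  have hκ1 : κ ^ 2 = 1 := by
    refine mul_left_cancel₀ hd2 ?_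
    rw [e₀, e₁, e₂] at hac
    rw [hdd]
    linear_combination -hac
  rcases sq_eq_one_iff.mp hκ1 with rfl | rfl
  · exact ⟨p, q, p', q', hd, rfl, rfl, rfl, rfl, rfl, rfl, by rw [e₀, one_mul],
      by rw [e₁, one_mul], by rw [e₂, one_mul]⟩
  · refine ⟨p, q, -p', -q', fun h0 => hd ?_, rfl, rfl, rfl, by ring, by ring, by ring, ?_, ?_, ?_⟩
    · rw [hdd]; linear_combination -h0
    · rw [e₀]; ring
    · rw [e₁]; ring
    · rw [e₂]; ring

end Parametrisation

/-! ### The parametrised conic and Mestre's sextic. -/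

section MestreSextic

variable {R : Type*} [CommRing R]

/-! Two minors and the determinant of the Gram matrix. -/

def gramMinor (A B C D : R) : R := gram₀ A B C * gram₂ D - gram₁ A B C ^ 2

def gramMinor' (A B C D : R) : R := gram₂ D ^ 2 - gram₁ A B C * gram₃ A B C

def gramDet (A B C D : R) : R :=
  gram₀ A B C * (gram₂ D * gram₄ A B C D - gram₃ A B C ^ 2) -
    gram₁ A B C * (gram₁ A B C * gram₄ A B C D - gram₂ D * gram₃ A B C) +
    gram₂ D * (gram₁ A B C * gram₃ A B C - gram₂ D ^ 2)

/-! A parametrisation of the conic of the Gram matrix, rational in a square root `δ` of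
`- gram₂ * gramDet`. -/

noncomputable def conicX (A B C D δ : R) : R[X] :=
  Polynomial.C (gram₂ D * (δ - gramMinor' A B C D)) * X ^ 2 -
    Polynomial.C (gramMinor A B C D * gram₂ D * (gramMinor' A B C D + δ))

noncomputable def conicY (A B C D δ : R) : R[X] :=
  Polynomial.C (gram₁ A B C * gramMinor' A B C D - gramMinor A B C D * gram₃ A B C -
      δ * gram₁ A B C) * X ^ 2 +
    Polynomial.C (2 * gramMinor A B C D * δ) * X +
    Polynomial.C (gramMinor A B C D * (gram₁ A B C * gramMinor' A B C D -
      gramMinor A B C D * gram₃ A B C + δ * gram₁ A B C))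

noncomputable def conicZ (A B C D : R) : R[X] :=
  Polynomial.C (gramMinor A B C D * gram₂ D) * X ^ 2 +
    Polynomial.C (gramMinor A B C D ^ 2 * gram₂ D)

/-- Mestre's sextic: the cubic restricted to the parametrised conic. -/
noncomputable def mestreSextic (A B C D δ : R) : R[X] :=
  mestreCubic (Polynomial.C A) (Polynomial.C B) (Polynomial.C C) (Polynomial.C D)
    (conicX A B C D δ) (conicY A B C D δ) (conicZ A B C D)

theorem eval_mestreSextic (A B C D δ x : R) : (mestreSextic A B C D δ).eval x =
    mestreCubic A B C D ((conicX A B C D δ).eval x) ((conicY A B C D δ).eval x)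
      ((conicZ A B C D).eval x) := by
  simp [mestreSextic, mestreCubic, mestre₁₁₁, mestre₁₁₂, mestre₁₁₃, mestre₁₂₂, mestre₁₂₃,
    mestre₁₃₃, mestre₂₂₂, mestre₂₂₃, mestre₂₃₃, mestre₃₃₃]

end MestreSextic

/-! ### Reconstruction over an algebraically closed field. -/

section AlgClosed

variable {E : Type*} [Field E] [IsAlgClosed E] [CharZero E]

/-- Eliminating `α²` from the expressions for `B` and `C` leaves a cubic for `β`, expressing that
`-2β` is an eigenvalue. Up to the factor `2`, `B³ - 6C²` is the squared Vandermonde of the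
eigenvalues, so the hypothesis makes them distinct. -/
theorem exists_diagRelations {B C : E} (A D : E) (h : B ^ 3 ≠ 6 * C ^ 2) :
    ∃ α β v₁ v₂ v₃, DiagRelations α β v₁ v₂ v₃ A B C D := by
  obtain ⟨β, hβ⟩ : ∃ β : E, 24 * β ^ 3 - 3 * B * β + C = 0 := by
    have hdeg : (Polynomial.C 24 * X ^ 3 + Polynomial.C 0 * X ^ 2 + Polynomial.C (-3 * B) * X +
        Polynomial.C C : E[X]).degree = 3 := degree_cubic (by norm_num)
    obtain ⟨β, hβ⟩ := IsAlgClosed.exists_root _ (by rw [hdeg]; norm_num)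
    refine ⟨β, ?_⟩
    simp only [IsRoot, eval_add, eval_mul, eval_C, eval_pow, eval_X] at hβ
    linear_combination hβ
  obtain ⟨α, hα⟩ := IsAlgClosed.exists_pow_nat_eq (B / 2 - 3 * β ^ 2) (n := 2) (by norm_num)
  have hB : B = 2 * α ^ 2 + 6 * β ^ 2 := by linear_combination -2 * hα
  have hC : C = 6 * β * (α ^ 2 - β ^ 2) := by
    rw [hB] at hβ; linear_combination hβ
  have hdisc : B ^ 3 - 6 * C ^ 2 = 2 * (2 * α * (α + 3 * β) * (3 * β - α)) ^ 2 := by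
    rw [hB, hC]; ring
  have hne : 2 * α * (α + 3 * β) * (3 * β - α) ≠ 0 := fun h0 => h (by
    rw [← sub_eq_zero, hdisc, h0]; ring)
  obtain ⟨⟨⟨-, h₁⟩, h₂⟩, h₃⟩ : ((True ∧ α ≠ 0) ∧ α + 3 * β ≠ 0) ∧ 3 * β - α ≠ 0 := by
    simpa [not_or] using hne
  obtain ⟨v₁, hv₁⟩ := IsAlgClosed.exists_pow_nat_eq ((gram₂ D + (α + β) * gram₁ A B C -
    2 * β * (β - α) * gram₀ A B C) / (72 * α * (α + 3 * β))) (n := 2) (by norm_num)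
  obtain ⟨v₂, hv₂⟩ := IsAlgClosed.exists_pow_nat_eq ((gram₂ D + (β - α) * gram₁ A B C -
    2 * β * (β + α) * gram₀ A B C) / (72 * α * (3 * β - α))) (n := 2) (by norm_num)
  obtain ⟨v₃, hv₃⟩ := IsAlgClosed.exists_pow_nat_eq ((gram₂ D - 2 * β * gram₁ A B C +
    (β ^ 2 - α ^ 2) * gram₀ A B C) / (- 36 * (α + 3 * β) * (3 * β - α))) (n := 2) (by norm_num)
  exact ⟨α, β, v₁, v₂, v₃, h₁, h₂, h₃, hB, hC, hv₁, hv₂, hv₃⟩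

/-- Mestre's sextic is a linear transform of a sextic with the prescribed Clebsch invariants. -/
theorem binaryForm_mestreSextic {A B C D δ : E} (hBC : B ^ 3 ≠ 6 * C ^ 2)
    (hδ : δ ^ 2 = -(gram₂ D * gramDet A B C D)) (hδ₀ : δ ≠ 0) (hD : gram₂ D ≠ 0)
    (hM : gramMinor A B C D ≠ 0) :
    ∃ α β v₁ v₂ v₃ a b c d, DiagRelations α β v₁ v₂ v₃ A B C D ∧ a * d - b * c ≠ 0 ∧
      binaryForm (mestreSextic A B C D δ) =
        MvPolynomial.C 324 * linSubst a b c d (diagForm α β v₁ v₂ v₃) := by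
  obtain ⟨α, β, v₁, v₂, v₃, h⟩ := exists_diagRelations A D hBC
  obtain ⟨m₀, m₁, m₂, m₃, m₄⟩ := h.moments
  -- `p₀, p₁, p₂` are the normalised coefficients of `x y₁ + y y₂ + z y₃`; `polar` identifies the
  -- polarised discriminant with the Gram form.
  let p₀ : E → E → E → E := fun x y z => v₁ * (x + (α + β) * y + (α + β) ^ 2 * z) +
    v₂ * (x + (β - α) * y + (β - α) ^ 2 * z)
  let p₁ : E → E → E → E := fun x y z => v₃ * (x - 2 * β * y + 4 * β ^ 2 * z)
  let p₂ : E → E → E → E := fun x y z => v₁ * (x + (α + β) * y + (α + β) ^ 2 * z) -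
    v₂ * (x + (β - α) * y + (β - α) ^ 2 * z)
  have polar : ∀ x y z x' y' z', p₀ x y z * p₂ x' y' z' + p₂ x y z * p₀ x' y' z' -
      2 * p₁ x y z * p₁ x' y' z' = (gram₀ A B C * (x * x') + gram₁ A B C * (x * y' + y * x') +
        gram₂ D * (x * z' + y * y' + z * x') + gram₃ A B C * (y * z' + z * y') +
        gram₄ A B C D * (z * z')) / 18 := by
    intro x y z x' y' z'
    rw [m₀, m₁, m₂, m₃, m₄]
    simp only [p₀, p₁, p₂]
    ring
  let s₀ := gram₀ A B C
  let s₁ := gram₁ A B C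
  let s₂ := gram₂ D
  let s₃ := gram₃ A B C
  let s₄ := gram₄ A B C D
  let M := gramMinor A B C D
  let m := gramMinor' A B C D
  have hMd : M = s₀ * s₂ - s₁ ^ 2 := rfl
  have hmd : m = s₂ ^ 2 - s₁ * s₃ := rfl
  have hδ' : δ ^ 2 = -(s₂ * (s₀ * (s₂ * s₄ - s₃ ^ 2) - s₁ * (s₁ * s₄ - s₂ * s₃) +
    s₂ * (s₁ * s₃ - s₂ ^ 2))) := hδ
  -- The three vectors are the coefficients of `t²`, `t` and `1` in the parametrisation (`conicX`,
  -- `conicY`, `conicZ`). The pairings that follow say that it lies on the conic identically in `t`,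
  -- with `hδ'` entering at `t⁴`, `t²` and `1`.
  have key := @exists_linear_sqrt E _ _ _
    (p₀ (s₂ * (δ - m)) (s₁ * m - M * s₃ - δ * s₁) (M * s₂))
    (p₁ (s₂ * (δ - m)) (s₁ * m - M * s₃ - δ * s₁) (M * s₂))
    (p₂ (s₂ * (δ - m)) (s₁ * m - M * s₃ - δ * s₁) (M * s₂))
    (p₀ 0 (2 * M * δ) 0) (p₁ 0 (2 * M * δ) 0) (p₂ 0 (2 * M * δ) 0)
    (p₀ (-(M * s₂ * (m + δ))) (M * (s₁ * m - M * s₃ + δ * s₁)) (M ^ 2 * s₂))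
    (p₁ (-(M * s₂ * (m + δ))) (M * (s₁ * m - M * s₃ + δ * s₁)) (M ^ 2 * s₂))
    (p₂ (-(M * s₂ * (m + δ))) (M * (s₁ * m - M * s₃ + δ * s₁)) (M ^ 2 * s₂))
  have q₂₂ := polar (s₂ * (δ - m)) (s₁ * m - M * s₃ - δ * s₁) (M * s₂)
    (s₂ * (δ - m)) (s₁ * m - M * s₃ - δ * s₁) (M * s₂)
  have q₀₀ := polar (-(M * s₂ * (m + δ))) (M * (s₁ * m - M * s₃ + δ * s₁)) (M ^ 2 * s₂)
    (-(M * s₂ * (m + δ))) (M * (s₁ * m - M * s₃ + δ * s₁)) (M ^ 2 * s₂)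
  have q₂₁ := polar (s₂ * (δ - m)) (s₁ * m - M * s₃ - δ * s₁) (M * s₂) 0 (2 * M * δ) 0
  have q₁₁ := polar 0 (2 * M * δ) 0 0 (2 * M * δ) 0
  have q₁₀ := polar 0 (2 * M * δ) 0
    (-(M * s₂ * (m + δ))) (M * (s₁ * m - M * s₃ + δ * s₁)) (M ^ 2 * s₂)
  have q₂₀ := polar (s₂ * (δ - m)) (s₁ * m - M * s₃ - δ * s₁) (M * s₂)
    (-(M * s₂ * (m + δ))) (M * (s₁ * m - M * s₃ + δ * s₁)) (M ^ 2 * s₂)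
  replace q₂₂ := q₂₂.trans (show _ = (0 : E) by
    change (s₀ * _ + s₁ * _ + s₂ * _ + s₃ * _ + s₄ * _) / 18 = (0 : E)
    rw [hMd, hmd]
    linear_combination s₂ * (s₀ * s₂ - s₁ ^ 2) / 18 * hδ')
  replace q₀₀ := q₀₀.trans (show _ = (0 : E) by
    change (s₀ * _ + s₁ * _ + s₂ * _ + s₃ * _ + s₄ * _) / 18 = (0 : E)
    rw [hMd, hmd]
    linear_combination s₂ * (s₀ * s₂ - s₁ ^ 2) ^ 3 / 18 * hδ')
  replace q₂₁ := q₂₁.trans (show _ = (0 : E) by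
    change (s₀ * _ + s₁ * _ + s₂ * _ + s₃ * _ + s₄ * _) / 18 = (0 : E)
    rw [hMd, hmd]
    ring)
  replace q₁₀ := q₁₀.trans (show _ = (0 : E) by
    change (s₀ * _ + s₁ * _ + s₂ * _ + s₃ * _ + s₄ * _) / 18 = (0 : E)
    rw [hMd, hmd]
    ring)
  replace q₁₁ := q₁₁.trans (show _ = s₂ * (2 * M * δ) ^ 2 / 18 by
    change (s₀ * _ + s₁ * _ + s₂ * _ + s₃ * _ + s₄ * _) / 18 = _
    ring)
  replace q₂₀ := q₂₀.trans (show _ = -(s₂ * (2 * M * δ) ^ 2 / 36) by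
    change (s₀ * _ + s₁ * _ + s₂ * _ + s₃ * _ + s₄ * _) / 18 = _
    rw [hMd, hmd]
    linear_combination (s₀ * s₂ - s₁ ^ 2) ^ 2 * s₂ / 18 * hδ')
  obtain ⟨p, q, p', q', hdet, ha₀, ha₁, ha₂, hc₀, hc₁, hc₂, hb₀, hb₁, hb₂⟩ := key
    (by linear_combination q₂₂ / 2) (by linear_combination q₀₀ / 2) (by linear_combination q₂₁)
    (by linear_combination q₁₀) (by linear_combination q₂₀ + q₁₁ / 2) (by
      rw [q₂₀]
      exact neg_ne_zero.mpr (div_ne_zero (mul_ne_zero hD (pow_ne_zero 2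
        (mul_ne_zero (mul_ne_zero two_ne_zero hM) hδ₀))) (by norm_num)))
  -- The substitution is `(X, Z) ↦ (Q, -P)` with `P = pX + p'Z` and `Q = qX + q'Z`.
  refine ⟨α, β, v₁, v₂, v₃, q, q', -p, -p', h, fun h0 => hdet (by linear_combination h0), ?_⟩
  rw [binaryForm_eq_homogenize]
  refine homogenize_eq_of_isHomogeneous
    (((isHomogeneous_linSubst _ _ _ _ (isHomogeneous_sexticForm _ _ _ _ _ _ _))).C_mul _) ?_
  rw [map_mul, aeval_linSubst]
  refine Polynomial.funext fun x => ?_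
  have hx : (MvPolynomial.aeval ![Polynomial.C q * X + Polynomial.C q',
      Polynomial.C (-p) * X + Polynomial.C (-p')] (diagForm α β v₁ v₂ v₃)).eval x =
      MvPolynomial.aeval ![q * x + q', -(p * x + p')] (diagForm α β v₁ v₂ v₃) := by
    rw [diagForm, aeval_sexticForm]
    simp [sexticForm]
    ring
  have hX : (conicX A B C D δ).eval x = s₂ * (δ - m) * x ^ 2 - M * s₂ * (m + δ) := by
    simp [conicX, s₂, m, M]
  have hY : (conicY A B C D δ).eval x = (s₁ * m - M * s₃ - δ * s₁) * x ^ 2 + 2 * M * δ * x +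
      M * (s₁ * m - M * s₃ + δ * s₁) := by
    simp [conicY, s₁, s₃, m, M]
  have hZ : (conicZ A B C D).eval x = M * s₂ * x ^ 2 + M ^ 2 * s₂ := by
    simp [conicZ, s₂, M]
  rw [eval_mul, hx, eval_mestreSextic, hX, hY, hZ]
  have := mestreCubic_eq_aeval_diagForm (P := p * x + p') (Q := q * x + q') h
    (x := s₂ * (δ - m) * x ^ 2 - M * s₂ * (m + δ))
    (y := (s₁ * m - M * s₃ - δ * s₁) * x ^ 2 + 2 * M * δ * x + M * (s₁ * m - M * s₃ + δ * s₁))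
    (z := M * s₂ * x ^ 2 + M ^ 2 * s₂) ?_ ?_ ?_
  · rw [this]; simp [Polynomial.algebraMap_eq]
  · simp only [p₀] at ha₀ hb₀ hc₀
    linear_combination -x ^ 2 * ha₀ - x * hb₀ - hc₀
  · simp only [p₁] at ha₁ hb₁ hc₁
    linear_combination -x ^ 2 * ha₁ - x * hb₁ - hc₁
  · simp only [p₂] at ha₂ hb₂ hc₂
    linear_combination -x ^ 2 * ha₂ - x * hb₂ - hc₂

end AlgClosed

/-! ### Base change, the decomposition `u + δ v`, and leading coefficients. -/

section Naturality

variable {R S : Type*} [CommRing R] [CommRing S] (φ : R →+* S) (A B C D x y z x' y' z' δ : R)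

theorem map_gram₀ : φ (gram₀ A B C) = gram₀ (φ A) (φ B) (φ C) := by
  simp [gram₀, _root_.map_ofNat]

theorem map_gram₁ : φ (gram₁ A B C) = gram₁ (φ A) (φ B) (φ C) := by
  simp [gram₁, _root_.map_ofNat]

theorem map_gram₂ : φ (gram₂ D) = gram₂ (φ D) := by
  simp [gram₂, _root_.map_ofNat]

theorem map_gram₃ : φ (gram₃ A B C) = gram₃ (φ A) (φ B) (φ C) := by
  simp [gram₃, _root_.map_ofNat]

theorem map_gram₄ : φ (gram₄ A B C D) = gram₄ (φ A) (φ B) (φ C) (φ D) := by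
  simp [gram₄, _root_.map_ofNat]

theorem map_gramMinor : φ (gramMinor A B C D) = gramMinor (φ A) (φ B) (φ C) (φ D) := by
  simp [gramMinor, map_gram₀, map_gram₁, map_gram₂]

theorem map_gramMinor' : φ (gramMinor' A B C D) = gramMinor' (φ A) (φ B) (φ C) (φ D) := by
  simp [gramMinor', map_gram₁, map_gram₂, map_gram₃]

theorem map_gramDet : φ (gramDet A B C D) = gramDet (φ A) (φ B) (φ C) (φ D) := by
  simp [gramDet, map_gram₀, map_gram₁, map_gram₂, map_gram₃, map_gram₄]

theorem map_mestre₁₁₁ : φ (mestre₁₁₁ A B C D) = mestre₁₁₁ (φ A) (φ B) (φ C) (φ D) := by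
  simp [mestre₁₁₁, _root_.map_ofNat]

theorem map_mestre₁₁₂ : φ (mestre₁₁₂ A B C D) = mestre₁₁₂ (φ A) (φ B) (φ C) (φ D) := by
  simp [mestre₁₁₂, _root_.map_ofNat]

theorem map_mestre₁₁₃ : φ (mestre₁₁₃ A B C D) = mestre₁₁₃ (φ A) (φ B) (φ C) (φ D) := by
  simp [mestre₁₁₃, _root_.map_ofNat]

theorem map_mestre₁₂₂ : φ (mestre₁₂₂ A B C D) = mestre₁₂₂ (φ A) (φ B) (φ C) (φ D) := by
  simp [mestre₁₂₂, _root_.map_ofNat]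

theorem map_mestre₁₂₃ : φ (mestre₁₂₃ A B C D) = mestre₁₂₃ (φ A) (φ B) (φ C) (φ D) := by
  simp [mestre₁₂₃, _root_.map_ofNat]

theorem map_mestre₁₃₃ : φ (mestre₁₃₃ A B C D) = mestre₁₃₃ (φ A) (φ B) (φ C) (φ D) := by
  simp [mestre₁₃₃, _root_.map_ofNat]

theorem map_mestre₂₂₂ : φ (mestre₂₂₂ A B C D) = mestre₂₂₂ (φ A) (φ B) (φ C) (φ D) := by
  simp [mestre₂₂₂, _root_.map_ofNat]

theorem map_mestre₂₂₃ : φ (mestre₂₂₃ A B C D) = mestre₂₂₃ (φ A) (φ B) (φ C) (φ D) := by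
  simp [mestre₂₂₃, _root_.map_ofNat]

theorem map_mestre₂₃₃ : φ (mestre₂₃₃ A B C D) = mestre₂₃₃ (φ A) (φ B) (φ C) (φ D) := by
  simp [mestre₂₃₃, _root_.map_ofNat]

theorem map_mestre₃₃₃ : φ (mestre₃₃₃ A B C D) = mestre₃₃₃ (φ A) (φ B) (φ C) (φ D) := by
  simp [mestre₃₃₃, _root_.map_ofNat]

theorem map_mestreCubic : φ (mestreCubic A B C D x y z) =
    mestreCubic (φ A) (φ B) (φ C) (φ D) (φ x) (φ y) (φ z) := by
  simp only [mestreCubic, map_add, map_mul, map_pow, _root_.map_ofNat, map_mestre₁₁₁,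
    map_mestre₁₁₂, map_mestre₁₁₃, map_mestre₁₂₂, map_mestre₁₂₃, map_mestre₁₃₃, map_mestre₂₂₂,
    map_mestre₂₂₃, map_mestre₂₃₃, map_mestre₃₃₃]

/-- The derivative of Mestre's cubic at `(x, y, z)` in the direction `(x', y', z')`. -/
def mestrePolar (A B C D x y z x' y' z' : R) : R :=
  3 * mestre₁₁₁ A B C D * x ^ 2 * x' +
    3 * mestre₁₁₂ A B C D * (2 * x * y * x' + x ^ 2 * y') +
    3 * mestre₁₁₃ A B C D * (2 * x * z * x' + x ^ 2 * z') +
    3 * mestre₁₂₂ A B C D * (y ^ 2 * x' + 2 * x * y * y') +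
    6 * mestre₁₂₃ A B C D * (y * z * x' + x * z * y' + x * y * z') +
    3 * mestre₁₃₃ A B C D * (z ^ 2 * x' + 2 * x * z * z') +
    3 * mestre₂₂₂ A B C D * y ^ 2 * y' +
    3 * mestre₂₂₃ A B C D * (2 * y * z * y' + y ^ 2 * z') +
    3 * mestre₂₃₃ A B C D * (z ^ 2 * y' + 2 * y * z * z') +
    3 * mestre₃₃₃ A B C D * z ^ 2 * z'

theorem map_mestrePolar : φ (mestrePolar A B C D x y z x' y' z') =
    mestrePolar (φ A) (φ B) (φ C) (φ D) (φ x) (φ y) (φ z) (φ x') (φ y') (φ z') := by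
  simp only [mestrePolar, map_add, map_mul, map_pow, _root_.map_ofNat, map_mestre₁₁₁,
    map_mestre₁₁₂, map_mestre₁₁₃, map_mestre₁₂₂, map_mestre₁₂₃, map_mestre₁₃₃, map_mestre₂₂₂,
    map_mestre₂₂₃, map_mestre₂₃₃, map_mestre₃₃₃]

theorem mestreCubic_add_mul (t : R) :
    mestreCubic A B C D (x + t * x') (y + t * y') (z + t * z') =
      mestreCubic A B C D x y z + t * mestrePolar A B C D x y z x' y' z' +
        t ^ 2 * mestrePolar A B C D x' y' z' x y z + t ^ 3 * mestreCubic A B C D x' y' z' := by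
  simp only [mestreCubic, mestrePolar]
  ring

theorem map_mestreSextic : (mestreSextic A B C D δ).map φ =
    mestreSextic (φ A) (φ B) (φ C) (φ D) (φ δ) := by
  have hX : (conicX A B C D δ).map φ = conicX (φ A) (φ B) (φ C) (φ D) (φ δ) := by
    simp [conicX, map_gram₂ φ, map_gramMinor φ, map_gramMinor' φ]
  have hY : (conicY A B C D δ).map φ = conicY (φ A) (φ B) (φ C) (φ D) (φ δ) := by
    simp [conicY, map_gram₁ φ, map_gram₃ φ, map_gramMinor φ, map_gramMinor' φ, _root_.map_ofNat]
  have hZ : (conicZ A B C D).map φ = conicZ (φ A) (φ B) (φ C) (φ D) := by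
    simp [conicZ, map_gram₂ φ, map_gramMinor φ]
  rw [mestreSextic, ← coe_mapRingHom, map_mestreCubic (mapRingHom φ)]
  simp only [coe_mapRingHom, hX, hY, hZ, Polynomial.map_C]
  rfl

/-! The decomposition `mestreSextic = u + δ v`. -/

noncomputable def conicX₀ (A B C D : R) : R[X] :=
  Polynomial.C (-(gram₂ D * gramMinor' A B C D)) * (X ^ 2 + Polynomial.C (gramMinor A B C D))

noncomputable def conicX₁ (A B C D : R) : R[X] :=
  Polynomial.C (gram₂ D) * (X ^ 2 - Polynomial.C (gramMinor A B C D))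

noncomputable def conicY₀ (A B C D : R) : R[X] :=
  Polynomial.C (gram₁ A B C * gramMinor' A B C D - gramMinor A B C D * gram₃ A B C) *
    (X ^ 2 + Polynomial.C (gramMinor A B C D))

noncomputable def conicY₁ (A B C D : R) : R[X] :=
  Polynomial.C (-gram₁ A B C) * (X ^ 2 - Polynomial.C (gramMinor A B C D)) +
    Polynomial.C (2 * gramMinor A B C D) * X

noncomputable def mestreU (A B C D : R) : R[X] :=
  mestreCubic (Polynomial.C A) (Polynomial.C B) (Polynomial.C C) (Polynomial.C D)
    (conicX₀ A B C D) (conicY₀ A B C D) (conicZ A B C D) +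
  Polynomial.C (-(gram₂ D * gramDet A B C D)) *
    mestrePolar (Polynomial.C A) (Polynomial.C B) (Polynomial.C C) (Polynomial.C D)
      (conicX₁ A B C D) (conicY₁ A B C D) 0 (conicX₀ A B C D) (conicY₀ A B C D) (conicZ A B C D)

noncomputable def mestreV (A B C D : R) : R[X] :=
  mestrePolar (Polynomial.C A) (Polynomial.C B) (Polynomial.C C) (Polynomial.C D)
    (conicX₀ A B C D) (conicY₀ A B C D) (conicZ A B C D) (conicX₁ A B C D) (conicY₁ A B C D) 0 +
  Polynomial.C (-(gram₂ D * gramDet A B C D)) *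
    mestreCubic (Polynomial.C A) (Polynomial.C B) (Polynomial.C C) (Polynomial.C D)
      (conicX₁ A B C D) (conicY₁ A B C D) 0

variable {A B C D δ}

/-- The parametrisation is affine in `δ`, with `z` free of `δ`. The Taylor expansion of the cubic
has degree three in `δ`, and replacing `δ²` by its value in the base ring sorts it into even and odd
parts. -/
theorem mestreSextic_eq_add (hδ : δ ^ 2 = -(gram₂ D * gramDet A B C D)) :
    mestreSextic A B C D δ = mestreU A B C D + Polynomial.C δ * mestreV A B C D := by
  have hX : conicX A B C D δ = conicX₀ A B C D + Polynomial.C δ * conicX₁ A B C D := by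
    simp only [conicX, conicX₀, conicX₁, map_mul, map_add, map_sub, map_neg]; ring
  have hY : conicY A B C D δ = conicY₀ A B C D + Polynomial.C δ * conicY₁ A B C D := by
    simp only [conicY, conicY₀, conicY₁, map_mul, map_add, map_sub, map_neg]; ring
  have hZ : conicZ A B C D = conicZ A B C D + Polynomial.C δ * 0 := by ring
  rw [mestreSextic, hX, hY, hZ, mestreCubic_add_mul, mestreU, mestreV, ← hδ, map_pow]
  ring

variable (A B C D)

theorem map_conicX₀ : (conicX₀ A B C D).map φ = conicX₀ (φ A) (φ B) (φ C) (φ D) := by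
  simp [conicX₀, map_gram₂ φ, map_gramMinor φ, map_gramMinor' φ]

theorem map_conicX₁ : (conicX₁ A B C D).map φ = conicX₁ (φ A) (φ B) (φ C) (φ D) := by
  simp [conicX₁, map_gram₂ φ, map_gramMinor φ]

theorem map_conicY₀ : (conicY₀ A B C D).map φ = conicY₀ (φ A) (φ B) (φ C) (φ D) := by
  simp [conicY₀, map_gram₁ φ, map_gram₃ φ, map_gramMinor φ, map_gramMinor' φ]

theorem map_conicY₁ : (conicY₁ A B C D).map φ = conicY₁ (φ A) (φ B) (φ C) (φ D) := by
  simp [conicY₁, map_gram₁ φ, map_gramMinor φ, _root_.map_ofNat]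

theorem map_conicZ : (conicZ A B C D).map φ = conicZ (φ A) (φ B) (φ C) (φ D) := by
  simp [conicZ, map_gram₂ φ, map_gramMinor φ]

theorem map_mestreU : (mestreU A B C D).map φ = mestreU (φ A) (φ B) (φ C) (φ D) := by
  rw [mestreU, ← coe_mapRingHom, map_add, map_mul, map_mestreCubic (mapRingHom φ),
    map_mestrePolar (mapRingHom φ)]
  simp only [coe_mapRingHom, Polynomial.map_C, map_conicX₀, map_conicX₁, map_conicY₀,
    map_conicY₁, map_conicZ, Polynomial.map_zero, map_neg, map_mul, map_gram₂ φ, map_gramDet φ]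
  simp only [mestreU, map_neg, map_mul]

theorem map_mestreV : (mestreV A B C D).map φ = mestreV (φ A) (φ B) (φ C) (φ D) := by
  rw [mestreV, ← coe_mapRingHom, map_add, map_mul, map_mestreCubic (mapRingHom φ),
    map_mestrePolar (mapRingHom φ)]
  simp only [coe_mapRingHom, Polynomial.map_C, map_conicX₀, map_conicX₁, map_conicY₀,
    map_conicY₁, map_conicZ, Polynomial.map_zero, map_neg, map_mul, map_gram₂ φ, map_gramDet φ]
  simp only [mestreV, map_neg, map_mul]

/-! The leading coefficients of `mestreU` and `mestreV`. -/

def leadU (A B C D : R) : R :=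
  mestreCubic A B C D (-(gram₂ D * gramMinor' A B C D))
    (gram₁ A B C * gramMinor' A B C D - gramMinor A B C D * gram₃ A B C)
    (gramMinor A B C D * gram₂ D) +
  (-(gram₂ D * gramDet A B C D)) * mestrePolar A B C D (gram₂ D) (-gram₁ A B C) 0
    (-(gram₂ D * gramMinor' A B C D))
    (gram₁ A B C * gramMinor' A B C D - gramMinor A B C D * gram₃ A B C)
    (gramMinor A B C D * gram₂ D)

def leadV (A B C D : R) : R :=
  mestrePolar A B C D (-(gram₂ D * gramMinor' A B C D))
    (gram₁ A B C * gramMinor' A B C D - gramMinor A B C D * gram₃ A B C)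
    (gramMinor A B C D * gram₂ D) (gram₂ D) (-gram₁ A B C) 0 +
  (-(gram₂ D * gramDet A B C D)) * mestreCubic A B C D (gram₂ D) (-gram₁ A B C) 0

theorem map_leadU : φ (leadU A B C D) = leadU (φ A) (φ B) (φ C) (φ D) := by
  simp only [leadU, map_add, map_sub, map_mul, map_neg, map_zero, map_mestreCubic, map_mestrePolar,
    map_gram₁, map_gram₂, map_gram₃, map_gramMinor, map_gramMinor', map_gramDet]

theorem map_leadV : φ (leadV A B C D) = leadV (φ A) (φ B) (φ C) (φ D) := by
  simp only [leadV, map_add, map_sub, map_mul, map_neg, map_zero, map_mestreCubic, map_mestrePolar,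
    map_gram₁, map_gram₂, map_gram₃, map_gramMinor, map_gramMinor', map_gramDet]

section LeadingCoefficients

variable {p q r p' q' r' : R[X]}

theorem coeff_six_mul (c : R) (hp : p.natDegree ≤ 2) (hq : q.natDegree ≤ 2)
    (hr : r.natDegree ≤ 2) :
    (Polynomial.C c * p * q * r).coeff 6 = c * p.coeff 2 * q.coeff 2 * r.coeff 2 := by
  have h₁ : (Polynomial.C c * p).natDegree ≤ 2 := (natDegree_C_mul_le c p).trans hp
  have h₂ : (Polynomial.C c * p * q).natDegree ≤ 2 + 2 := natDegree_mul_le_of_le h₁ hq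
  rw [show 6 = 2 + 2 + 2 from rfl, coeff_mul_add_eq_of_natDegree_le h₂ hr,
    coeff_mul_add_eq_of_natDegree_le h₁ hq, coeff_C_mul]

theorem mestreCubic_C_eq :
    mestreCubic (Polynomial.C A) (Polynomial.C B) (Polynomial.C C) (Polynomial.C D) p q r =
      Polynomial.C (mestre₁₁₁ A B C D) * p * p * p +
      Polynomial.C (3 * mestre₁₁₂ A B C D) * p * p * q +
      Polynomial.C (3 * mestre₁₁₃ A B C D) * p * p * r +
      Polynomial.C (3 * mestre₁₂₂ A B C D) * p * q * q +
      Polynomial.C (6 * mestre₁₂₃ A B C D) * p * q * r +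
      Polynomial.C (3 * mestre₁₃₃ A B C D) * p * r * r +
      Polynomial.C (mestre₂₂₂ A B C D) * q * q * q +
      Polynomial.C (3 * mestre₂₂₃ A B C D) * q * q * r +
      Polynomial.C (3 * mestre₂₃₃ A B C D) * q * r * r +
      Polynomial.C (mestre₃₃₃ A B C D) * r * r * r := by
  simp only [mestreCubic, map_mul, _root_.map_ofNat, map_mestre₁₁₁, map_mestre₁₁₂,
    map_mestre₁₁₃, map_mestre₁₂₂, map_mestre₁₂₃, map_mestre₁₃₃, map_mestre₂₂₂,
    map_mestre₂₂₃, map_mestre₂₃₃, map_mestre₃₃₃]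
  ring

theorem coeff_six_mestreCubic (hp : p.natDegree ≤ 2) (hq : q.natDegree ≤ 2)
    (hr : r.natDegree ≤ 2) :
    (mestreCubic (Polynomial.C A) (Polynomial.C B) (Polynomial.C C) (Polynomial.C D) p q
      r).coeff 6 =
      mestreCubic A B C D (p.coeff 2) (q.coeff 2) (r.coeff 2) := by
  rw [mestreCubic_C_eq]
  simp only [coeff_add, coeff_six_mul, hp, hq, hr]
  simp only [mestreCubic]
  ring

theorem natDegree_mestreCubic_le (hp : p.natDegree ≤ 2) (hq : q.natDegree ≤ 2)
    (hr : r.natDegree ≤ 2) :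
    (mestreCubic (Polynomial.C A) (Polynomial.C B) (Polynomial.C C) (Polynomial.C D)
      p q r).natDegree ≤ 6 := by
  have h : ∀ (c : R) {p q r : R[X]}, p.natDegree ≤ 2 → q.natDegree ≤ 2 → r.natDegree ≤ 2 →
      (Polynomial.C c * p * q * r).natDegree ≤ 6 := fun c p q r hp hq hr =>
    natDegree_mul_le_of_le (natDegree_mul_le_of_le ((natDegree_C_mul_le c p).trans hp) hq) hr
  rw [mestreCubic_C_eq]
  iterate 9 refine natDegree_add_le_of_degree_le ?_ (h _ ‹_› ‹_› ‹_›)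
  exact h _ hp hp hp

theorem coeff_six_mestrePolar (hp : p.natDegree ≤ 2) (hq : q.natDegree ≤ 2)
    (hr : r.natDegree ≤ 2) (hp' : p'.natDegree ≤ 2) (hq' : q'.natDegree ≤ 2)
    (hr' : r'.natDegree ≤ 2) :
    (mestrePolar (Polynomial.C A) (Polynomial.C B) (Polynomial.C C) (Polynomial.C D)
      p q r p' q' r').coeff 6 =
      mestrePolar A B C D (p.coeff 2) (q.coeff 2) (r.coeff 2) (p'.coeff 2) (q'.coeff 2)
        (r'.coeff 2) := by
  have h : mestrePolar (Polynomial.C A) (Polynomial.C B) (Polynomial.C C) (Polynomial.C D)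
        p q r p' q' r' =
      Polynomial.C (3 * mestre₁₁₁ A B C D) * p * p * p' +
      (Polynomial.C (6 * mestre₁₁₂ A B C D) * p * q * p' +
        Polynomial.C (3 * mestre₁₁₂ A B C D) * p * p * q') +
      (Polynomial.C (6 * mestre₁₁₃ A B C D) * p * r * p' +
        Polynomial.C (3 * mestre₁₁₃ A B C D) * p * p * r') +
      (Polynomial.C (3 * mestre₁₂₂ A B C D) * q * q * p' +
        Polynomial.C (6 * mestre₁₂₂ A B C D) * p * q * q') +
      (Polynomial.C (6 * mestre₁₂₃ A B C D) * q * r * p' +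
        Polynomial.C (6 * mestre₁₂₃ A B C D) * p * r * q' +
        Polynomial.C (6 * mestre₁₂₃ A B C D) * p * q * r') +
      (Polynomial.C (3 * mestre₁₃₃ A B C D) * r * r * p' +
        Polynomial.C (6 * mestre₁₃₃ A B C D) * p * r * r') +
      Polynomial.C (3 * mestre₂₂₂ A B C D) * q * q * q' +
      (Polynomial.C (6 * mestre₂₂₃ A B C D) * q * r * q' +
        Polynomial.C (3 * mestre₂₂₃ A B C D) * q * q * r') +
      (Polynomial.C (3 * mestre₂₃₃ A B C D) * r * r * q' +
        Polynomial.C (6 * mestre₂₃₃ A B C D) * q * r * r') +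
      Polynomial.C (3 * mestre₃₃₃ A B C D) * r * r * r' := by
    simp only [mestrePolar, map_mul, _root_.map_ofNat, map_mestre₁₁₁, map_mestre₁₁₂,
      map_mestre₁₁₃, map_mestre₁₂₂, map_mestre₁₂₃, map_mestre₁₃₃, map_mestre₂₂₂,
      map_mestre₂₂₃, map_mestre₂₃₃, map_mestre₃₃₃]
    ring
  rw [h]
  simp only [coeff_add, coeff_six_mul, hp, hq, hr, hp', hq', hr']
  simp only [mestrePolar]
  ring

end LeadingCoefficients

theorem natDegree_conicX₀_le : (conicX₀ A B C D).natDegree ≤ 2 := by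
  unfold conicX₀; compute_degree

theorem natDegree_conicX₁_le : (conicX₁ A B C D).natDegree ≤ 2 := by
  unfold conicX₁; compute_degree

theorem natDegree_conicY₀_le : (conicY₀ A B C D).natDegree ≤ 2 := by
  unfold conicY₀; compute_degree

theorem natDegree_conicY₁_le : (conicY₁ A B C D).natDegree ≤ 2 := by
  unfold conicY₁; compute_degree

theorem natDegree_conicZ_le : (conicZ A B C D).natDegree ≤ 2 := by
  unfold conicZ; compute_degree

theorem coeff_two_conic : (conicX₀ A B C D).coeff 2 = -(gram₂ D * gramMinor' A B C D) ∧
    (conicX₁ A B C D).coeff 2 = gram₂ D ∧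
    (conicY₀ A B C D).coeff 2 =
      gram₁ A B C * gramMinor' A B C D - gramMinor A B C D * gram₃ A B C ∧
    (conicY₁ A B C D).coeff 2 = -gram₁ A B C ∧
    (conicZ A B C D).coeff 2 = gramMinor A B C D * gram₂ D := by
  refine ⟨?_, ?_, ?_, ?_, ?_⟩
  · rw [conicX₀, coeff_C_mul]; simp [coeff_X_pow]
  · rw [conicX₁, coeff_C_mul]; simp [coeff_X_pow]
  · rw [conicY₀, coeff_C_mul]; simp [coeff_X_pow]
  · rw [conicY₁, coeff_add, coeff_C_mul, coeff_C_mul]; simp [coeff_X_pow, coeff_X]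
  · rw [conicZ, coeff_add, coeff_C_mul]
    simp [coeff_X_pow, coeff_C_succ, -map_mul, -map_pow]

theorem coeff_six_mestreU : (mestreU A B C D).coeff 6 = leadU A B C D := by
  obtain ⟨h₁, h₂, h₃, h₄, h₅⟩ := coeff_two_conic A B C D
  rw [mestreU, coeff_add, coeff_C_mul, coeff_six_mestreCubic, coeff_six_mestrePolar, h₁, h₂, h₃,
    h₄, h₅, coeff_zero, leadU] <;>
  first
  | exact natDegree_conicX₀_le A B C D
  | exact natDegree_conicX₁_le A B C D
  | exact natDegree_conicY₀_le A B C D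
  | exact natDegree_conicY₁_le A B C D
  | exact natDegree_conicZ_le A B C D
  | simp

theorem coeff_six_mestreV : (mestreV A B C D).coeff 6 = leadV A B C D := by
  obtain ⟨h₁, h₂, h₃, h₄, h₅⟩ := coeff_two_conic A B C D
  rw [mestreV, coeff_add, coeff_C_mul, coeff_six_mestreCubic, coeff_six_mestrePolar, h₁, h₂, h₃,
    h₄, h₅, coeff_zero, leadV] <;>
  first
  | exact natDegree_conicX₀_le A B C D
  | exact natDegree_conicX₁_le A B C D
  | exact natDegree_conicY₀_le A B C D
  | exact natDegree_conicY₁_le A B C D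
  | exact natDegree_conicZ_le A B C D
  | simp

theorem natDegree_mestreSextic_le (δ : R) : (mestreSextic A B C D δ).natDegree ≤ 6 := by
  have hX : (conicX A B C D δ).natDegree ≤ 2 := by unfold conicX; compute_degree
  have hY : (conicY A B C D δ).natDegree ≤ 2 := by unfold conicY; compute_degree
  have hZ := natDegree_conicZ_le A B C D
  exact natDegree_mestreCubic_le A B C D hX hY hZ

end Naturality

/-! ### Invariants of Mestre's sextic over an arbitrary field. -/

section ClebschInvariants

variable {k : Type*} [Field k] [CharZero k] {A B C D δ : k}

/-- The Clebsch invariants of Mestre's sextic are the given ones, up to weighted scaling. -/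
theorem exists_clebsch_mestreSextic (hBC : B ^ 3 ≠ 6 * C ^ 2)
    (hδ : δ ^ 2 = -(gram₂ D * gramDet A B C D)) (hδ₀ : δ ≠ 0) (hD : gram₂ D ≠ 0)
    (hM : gramMinor A B C D ≠ 0) :
    ∃ r : AlgebraicClosure k, r ≠ 0 ∧
      algebraMap k _ (clebschA (mestreSextic A B C D δ)) = r * algebraMap k _ A ∧
      algebraMap k _ (clebschB (mestreSextic A B C D δ)) = r ^ 2 * algebraMap k _ B ∧
      algebraMap k _ (clebschC (mestreSextic A B C D δ)) = r ^ 3 * algebraMap k _ C ∧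
      algebraMap k _ (clebschD (mestreSextic A B C D δ)) = r ^ 5 * algebraMap k _ D := by
  let φ := algebraMap k (AlgebraicClosure k)
  have : CharZero (AlgebraicClosure k) := charZero_of_injective_algebraMap φ.injective
  obtain ⟨α, β, v₁, v₂, v₃, a, b, c, d, h, hdet, hf⟩ :=
    binaryForm_mestreSextic (A := φ A) (B := φ B) (C := φ C) (D := φ D) (δ := φ δ)
      (fun h => hBC (φ.injective (by simpa [_root_.map_ofNat] using h)))
      (by rw [← map_gram₂, ← map_gramDet, ← map_pow, hδ, map_neg, map_mul])
      ((map_ne_zero φ).mpr hδ₀)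
      (by rw [← map_gram₂]; exact (map_ne_zero φ).mpr hD)
      (by rw [← map_gramMinor]; exact (map_ne_zero φ).mpr hM)
  obtain ⟨hB, hC, hD'⟩ := formBCD_diagForm h
  -- The substitution exists only over the algebraic closure, so the scaling factor is produced
  -- there.
  refine ⟨324 ^ 2 * (a * d - b * c) ^ 6, by simp [hdet], ?_, ?_, ?_, ?_⟩
  · rw [← clebschA_map, map_mestreSextic, clebschA_eq_formA, hf, formA_linSubst, formA_diagForm h]
  · rw [← clebschB_map, map_mestreSextic, clebschB_eq_formB, hf, formB_linSubst, hB]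
  · rw [← clebschC_map, map_mestreSextic, clebschC_eq_formC, hf, formC_linSubst, hC]
  · rw [← clebschD_map, map_mestreSextic, clebschD_eq_formD, hf, formD_linSubst, hD']

end ClebschInvariants

/-! ### Clebsch invariants attached to `(j₁, j₂, j₃)`. -/

section Moduli

variable {R : Type*} [CommRing R] {S : Type*} [CommRing S] (φ : R →+* S) (j₁ j₂ j₃ : R)

/-! The Clebsch invariants with absolute Igusa invariants `j₁, j₂, j₃`, normalised by
`I₂ = 1800 j₁`. -/

def moduliA : R := -15 * j₁

def moduliB : R := 480 * j₁ * j₂ + 24 * j₁ ^ 2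

def moduliC : R := 28800 * j₁ ^ 2 * j₃ - 48 * j₁ ^ 3 - 3840 * j₁ ^ 2 * j₂

/-- Obtained by solving `I₁₀ = 1800⁵ j₁⁴` for `D`. The constant `1800` makes all four invariants
integral polynomials in `j₁, j₂, j₃`. -/
def moduliD : R :=
  10368 * j₁ ^ 5 - 720 * j₁ ^ 3 * moduliB j₁ j₂ + 80 * j₁ ^ 2 * moduliC j₁ j₂ j₃ +
    10 * j₁ * moduliB j₁ j₂ ^ 2 - 32 * (20 * j₁ * j₂ + j₁ ^ 2) * moduliC j₁ j₂ j₃ -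
    4147200000 * j₁ ^ 4

theorem map_moduliA : φ (moduliA j₁) = moduliA (φ j₁) := by
  simp [moduliA, _root_.map_ofNat]

theorem map_moduliB : φ (moduliB j₁ j₂) = moduliB (φ j₁) (φ j₂) := by
  simp [moduliB, _root_.map_ofNat]

theorem map_moduliC : φ (moduliC j₁ j₂ j₃) = moduliC (φ j₁) (φ j₂) (φ j₃) := by
  simp [moduliC, _root_.map_ofNat]

theorem map_moduliD : φ (moduliD j₁ j₂ j₃) = moduliD (φ j₁) (φ j₂) (φ j₃) := by
  simp [moduliD, map_moduliB, map_moduliC, _root_.map_ofNat]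

end Moduli

/-! ### Nonvanishing by specialisation at `(1, 0, 1)`. -/

section Generic

variable {k : Type*} [Field k] [CharZero k] {j₁ j₂ j₃ : k}

theorem aeval_aeval_moduli {l : Type*} [CommRing l] [Algebra ℚ l] (x y z : l)
    (P : MvPolynomial (Fin 4) ℚ) :
    MvPolynomial.aeval ![x, y, z] (MvPolynomial.aeval
      ![moduliA (.X 0 : MvPolynomial (Fin 3) ℚ), moduliB (.X 0) (.X 1),
        moduliC (.X 0) (.X 1) (.X 2), moduliD (.X 0) (.X 1) (.X 2)] P) =
      MvPolynomial.aeval ![moduliA x, moduliB x y, moduliC x y z, moduliD x y z] P := by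
  let φ : MvPolynomial (Fin 3) ℚ →+* l := (MvPolynomial.aeval ![x, y, z]).toRingHom
  rw [← AlgHom.comp_apply, MvPolynomial.comp_aeval]
  congr 2
  ext i
  fin_cases i
  · simpa [φ] using map_moduliA φ (.X 0)
  · simpa [φ] using map_moduliB φ (.X 0) (.X 1)
  · simpa [φ] using map_moduliC φ (.X 0) (.X 1) (.X 2)
  · simpa [φ] using map_moduliD φ (.X 0) (.X 1) (.X 2)

/-- A polynomial expression in the Clebsch invariants that does not vanish for
`(j₁, j₂, j₃) = (1, 0, 1)` does not vanish for algebraically independent `j₁, j₂, j₃`. -/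
theorem aeval_moduli_ne_zero (hj : AlgebraicIndependent ℚ ![j₁, j₂, j₃])
    {P : MvPolynomial (Fin 4) ℚ}
    (hP : MvPolynomial.aeval (R := ℚ) ![-15, 24, 28752, (-4145821056 : ℚ)] P ≠ 0) :
    MvPolynomial.aeval ![moduliA j₁, moduliB j₁ j₂, moduliC j₁ j₂ j₃, moduliD j₁ j₂ j₃] P ≠ 0 := by
  have h₂ := aeval_aeval_moduli (1 : ℚ) 0 1 P
  rw [← aeval_aeval_moduli]
  refine fun h => hP ?_
  rw [hj.eq_zero_of_aeval_eq_zero _ h, map_zero] at h₂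
  rw [h₂]
  norm_num [moduliA, moduliB, moduliC, moduliD]

theorem gram₂_moduli_ne_zero (hj : AlgebraicIndependent ℚ ![j₁, j₂, j₃]) :
    gram₂ (moduliD j₁ j₂ j₃) ≠ 0 := by
  have h := aeval_moduli_ne_zero hj (P := gram₂ (.X 3))
  simp only [← AlgHom.coe_toRingHom, map_gram₂] at h
  simp only [AlgHom.coe_toRingHom, MvPolynomial.aeval_X, Matrix.cons_val] at h
  exact h (by norm_num [gram₂])

theorem gramMinor_moduli_ne_zero (hj : AlgebraicIndependent ℚ ![j₁, j₂, j₃]) :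
    gramMinor (moduliA j₁) (moduliB j₁ j₂) (moduliC j₁ j₂ j₃) (moduliD j₁ j₂ j₃) ≠ 0 := by
  have h := aeval_moduli_ne_zero hj (P := gramMinor (.X 0) (.X 1) (.X 2) (.X 3))
  simp only [← AlgHom.coe_toRingHom, map_gramMinor] at h
  simp only [AlgHom.coe_toRingHom, MvPolynomial.aeval_X, Matrix.cons_val] at h
  exact h (by norm_num [gramMinor, gram₀, gram₁, gram₂])

theorem gramDet_moduli_ne_zero (hj : AlgebraicIndependent ℚ ![j₁, j₂, j₃]) :
    gramDet (moduliA j₁) (moduliB j₁ j₂) (moduliC j₁ j₂ j₃) (moduliD j₁ j₂ j₃) ≠ 0 := by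
  have h := aeval_moduli_ne_zero hj (P := gramDet (.X 0) (.X 1) (.X 2) (.X 3))
  simp only [← AlgHom.coe_toRingHom, map_gramDet] at h
  simp only [AlgHom.coe_toRingHom, MvPolynomial.aeval_X, Matrix.cons_val] at h
  exact h (by norm_num [gramDet, gram₀, gram₁, gram₂, gram₃, gram₄])

theorem moduliB_pow_ne (hj : AlgebraicIndependent ℚ ![j₁, j₂, j₃]) :
    moduliB j₁ j₂ ^ 3 ≠ 6 * moduliC j₁ j₂ j₃ ^ 2 := by
  have h := aeval_moduli_ne_zero hj (P := .X 1 ^ 3 - 6 * .X 2 ^ 2)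
  simp only [map_sub, map_mul, map_pow, _root_.map_ofNat, MvPolynomial.aeval_X,
    Matrix.cons_val] at h
  exact sub_ne_zero.mp (h (by norm_num))

/-- Separates the two curves: their leading coefficients differ by `2δ` times this quantity. -/
theorem leadV_moduli_ne_zero (hj : AlgebraicIndependent ℚ ![j₁, j₂, j₃]) :
    leadV (moduliA j₁) (moduliB j₁ j₂) (moduliC j₁ j₂ j₃) (moduliD j₁ j₂ j₃) ≠ 0 := by
  have h := aeval_moduli_ne_zero hj (P := leadV (.X 0) (.X 1) (.X 2) (.X 3))
  simp only [← AlgHom.coe_toRingHom, map_leadV] at h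
  simp only [AlgHom.coe_toRingHom, MvPolynomial.aeval_X, Matrix.cons_val] at h
  exact h (by norm_num [leadV, mestreCubic, mestrePolar, mestre₁₁₁, mestre₁₁₂, mestre₁₁₃, mestre₁₂₂,
    mestre₁₂₃, mestre₁₃₃, mestre₂₂₂, mestre₂₂₃, mestre₂₃₃, mestre₃₃₃, gramMinor, gramMinor',
    gramDet, gram₀, gram₁, gram₂, gram₃, gram₄])

/-- This is the product of the leading coefficients of `u + δ v` and `u - δ v`, so both sextics have
degree exactly six. -/
theorem leadU_sq_moduli_ne (hj : AlgebraicIndependent ℚ ![j₁, j₂, j₃]) {A B C D : k}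
    (hA : A = moduliA j₁) (hB : B = moduliB j₁ j₂) (hC : C = moduliC j₁ j₂ j₃)
    (hD : D = moduliD j₁ j₂ j₃) :
    leadU A B C D ^ 2 - -(gram₂ D * gramDet A B C D) * leadV A B C D ^ 2 ≠ 0 := by
  subst hA hB hC hD
  have h := aeval_moduli_ne_zero hj (P := leadU (.X 0) (.X 1) (.X 2) (.X 3) ^ 2 -
    -(gram₂ (.X 3) * gramDet (.X 0) (.X 1) (.X 2) (.X 3)) * leadV (.X 0) (.X 1) (.X 2) (.X 3) ^ 2)
  simp only [← AlgHom.coe_toRingHom, map_sub, map_neg, map_mul, map_pow, map_leadU, map_leadV,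
    map_gram₂, map_gramDet] at h
  simp only [AlgHom.coe_toRingHom, MvPolynomial.aeval_X, Matrix.cons_val] at h
  exact h (by norm_num [leadU, leadV, mestreCubic, mestrePolar, mestre₁₁₁, mestre₁₁₂, mestre₁₁₃,
    mestre₁₂₂, mestre₁₂₃, mestre₁₃₃, mestre₂₂₂, mestre₂₂₃, mestre₂₃₃, mestre₃₃₃, gramMinor,
    gramMinor', gramDet, gram₀, gram₁, gram₂, gram₃, gram₄])

theorem ne_zero_of_algebraicIndependent (hj : AlgebraicIndependent ℚ ![j₁, j₂, j₃]) : j₁ ≠ 0 :=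
  hj.ne_zero 0

end Generic

/-! ### Comparison of `d` with the square root `δ`. -/

section DSq

variable {k : Type*} [Field k] [CharZero k] {j₁ : k}

/-- The product `gram₂ * gramDet` is of degree four in the moments, each carrying a factor `18`,
whence `18⁴ = 324²`. It has weight `20` when `A` has weight one, and is made weightless by `I₂²⁰`
with `I₂ = 1800 j₁`. -/
theorem mul_dSq_eq (h : j₁ ≠ 0) (j₂ j₃ : k) :
    (324 * (1800 * j₁) ^ 10) ^ 2 * dSq j₁ j₂ j₃ = -(gram₂ (moduliD j₁ j₂ j₃) *
      gramDet (moduliA j₁) (moduliB j₁ j₂) (moduliC j₁ j₂ j₃) (moduliD j₁ j₂ j₃)) := by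
  simp only [dSq, gramDet, gram₀, gram₁, gram₂, gram₃, gram₄, moduliA, moduliB, moduliC, moduliD]
  field_simp
  ring

theorem map_dSq {k l : Type*} [Field k] [Field l] (φ : k →+* l) (j₁ j₂ j₃ : k) :
    φ (dSq j₁ j₂ j₃) = dSq (φ j₁) (φ j₂) (φ j₃) := by
  simp [dSq, _root_.map_ofNat]

end DSq

/-- The Igusa invariants are computed in the algebraic closure, where they are the prescribed ones
up to powers of `r`. In particular `I₁₀` is a nonzero multiple of `j₁⁴`, which gives separability.
-/
theorem exists_curve_mestreSextic {k : Type*} [Field k] [CharZero k] {j₁ j₂ j₃ δ : k}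
    (hj : AlgebraicIndependent ℚ ![j₁, j₂, j₃])
    (hδ : δ ^ 2 = -(gram₂ (moduliD j₁ j₂ j₃) *
      gramDet (moduliA j₁) (moduliB j₁ j₂) (moduliC j₁ j₂ j₃) (moduliD j₁ j₂ j₃))) :
    ∃ Cv : Curve k, Cv.sextic =
      mestreSextic (moduliA j₁) (moduliB j₁ j₂) (moduliC j₁ j₂ j₃) (moduliD j₁ j₂ j₃) δ ∧
      Cv.absInv₁ = j₁ ∧ Cv.absInv₂ = j₂ ∧ Cv.absInv₃ = j₃ := by
  have hj₁ := ne_zero_of_algebraicIndependent hj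
  have hD := gram₂_moduli_ne_zero hj
  have hδ₀ : δ ≠ 0 := by
    rintro rfl
    rw [zero_pow two_ne_zero] at hδ
    exact neg_ne_zero.mpr (mul_ne_zero hD (gramDet_moduli_ne_zero hj)) hδ.symm
  obtain ⟨r, hr, hA, hB, hC, hD'⟩ := exists_clebsch_mestreSextic (moduliB_pow_ne hj) hδ hδ₀ hD
    (gramMinor_moduli_ne_zero hj)
  have hlead := leadU_sq_moduli_ne hj rfl rfl rfl rfl
  have hadd := mestreSextic_eq_add hδ
  have hdeg := natDegree_mestreSextic_le (moduliA j₁) (moduliB j₁ j₂) (moduliC j₁ j₂ j₃)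
    (moduliD j₁ j₂ j₃) δ
  set f := mestreSextic (moduliA j₁) (moduliB j₁ j₂) (moduliC j₁ j₂ j₃) (moduliD j₁ j₂ j₃) δ
  let φ := algebraMap k (AlgebraicClosure k)
  have : CharZero (AlgebraicClosure k) := charZero_of_injective_algebraMap φ.injective
  have h₂ : φ (I₂ f) = r * (1800 * φ j₁) := by
    simp only [I₂, φ, map_mul, map_neg, _root_.map_ofNat, hA, moduliA]
    ring
  have h₄ : φ (I₄ f) = r ^ 2 * (1800 ^ 2 * φ j₁ * φ j₂) := by
    simp only [I₄, φ, map_mul, map_add, map_pow, map_neg, _root_.map_ofNat, hA, hB, moduliA,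
      moduliB]
    ring
  have h₆ : φ (I₆ f) = r ^ 3 * (1800 ^ 3 * φ j₁ ^ 2 * φ j₃) := by
    simp only [I₆, φ, map_mul, map_add, map_sub, map_pow, map_neg, _root_.map_ofNat, hA, hB, hC,
      moduliA, moduliB, moduliC]
    ring
  have h₁₀ : φ (I₁₀ f) = r ^ 5 * (1800 ^ 5 * φ j₁ ^ 4) := by
    simp only [I₁₀, φ, map_mul, map_add, map_sub, map_pow, map_neg, _root_.map_ofNat, hA, hB, hC,
      hD', moduliA, moduliB, moduliC, moduliD]
    ring
  have hφ₁ : φ j₁ ≠ 0 := (map_ne_zero φ).mpr hj₁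
  have hI₁₀ : I₁₀ f ≠ 0 := (map_ne_zero φ).mp (by rw [h₁₀]; simp [hr, hφ₁])
  have hcoeff : f.coeff 6 ≠ 0 := by
    rw [hadd, coeff_add, coeff_C_mul, coeff_six_mestreU, coeff_six_mestreV]
    rw [← hδ, ← mul_pow, sq_sub_sq] at hlead
    exact left_ne_zero_of_mul hlead
  refine ⟨⟨f, hdeg.antisymm (le_natDegree_of_ne_zero hcoeff),
    separable_of_I₁₀_ne_zero hdeg hI₁₀⟩, rfl, ?_, ?_, ?_⟩
  · refine φ.injective ?_
    rw [Curve.absInv₁, map_div₀, map_pow, h₂, h₁₀]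
    field_simp
  · refine φ.injective ?_
    rw [Curve.absInv₂, map_div₀, map_mul, map_pow, h₂, h₄, h₁₀]
    field_simp
  · refine φ.injective ?_
    rw [Curve.absInv₃, map_div₀, map_mul, map_pow, h₂, h₆, h₁₀]
    field_simp

end GenusTwo

/-! ### The pair of conjugate curves over `K(d)`. -/

open GenusTwo

theorem mainTheorem2 {F : Type*} [Field F] [CharZero F] (j₁ j₂ j₃ d : F)
    (hj : AlgebraicIndependent ℚ ![j₁, j₂, j₃])
    (hd : d ^ 2 = GenusTwo.dSq j₁ j₂ j₃) :
    ∃ Cplus Cminus : GenusTwo.Curve ((GenusTwo.moduliField j₁ j₂ j₃)⟮d⟯),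
      -- the two curves are distinct and are exchanged by `d ↦ -d`
      Cplus ≠ Cminus ∧
      (∃ u v : (GenusTwo.moduliField j₁ j₂ j₃)[X],
        Cplus.sextic =
          u.map (algebraMap _ _) +
            C (AdjoinSimple.gen (GenusTwo.moduliField j₁ j₂ j₃) d) * v.map (algebraMap _ _) ∧
        Cminus.sextic =
          u.map (algebraMap _ _) -
            C (AdjoinSimple.gen (GenusTwo.moduliField j₁ j₂ j₃) d) * v.map (algebraMap _ _)) ∧
      (Cplus.absInv₁ : F) = j₁ ∧ (Cplus.absInv₂ : F) = j₂ ∧ (Cplus.absInv₃ : F) = j₃ ∧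
      (Cminus.absInv₁ : F) = j₁ ∧ (Cminus.absInv₂ : F) = j₂ ∧ (Cminus.absInv₃ : F) = j₃ := by
  let K := moduliField j₁ j₂ j₃
  let L := K⟮d⟯
  have hmem : ∀ x ∈ ({j₁, j₂, j₃} : Set F), x ∈ K := fun x hx => subset_adjoin ℚ _ hx
  let a₁ : K := ⟨j₁, hmem _ (by simp)⟩
  let a₂ : K := ⟨j₂, hmem _ (by simp)⟩
  let a₃ : K := ⟨j₃, hmem _ (by simp)⟩
  let φ : K →+* L := algebraMap K L
  let ψ : L →ₐ[ℚ] F := L.val.restrictScalars ℚ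
  have hψ : Function.Injective ψ := ψ.toRingHom.injective
  have hψφ : ∀ x : K, ψ (φ x) = x := fun x => rfl
  have hjL : AlgebraicIndependent ℚ ![φ a₁, φ a₂, φ a₃] := by
    rw [← ψ.algebraicIndependent_iff hψ]
    convert hj
    ext i
    fin_cases i <;> rfl
  let g : L := AdjoinSimple.gen K d
  have hg : g ^ 2 = dSq (φ a₁) (φ a₂) (φ a₃) := by
    apply hψ
    rw [map_pow]
    refine Eq.trans ?_ (map_dSq ψ.toRingHom (φ a₁) (φ a₂) (φ a₃)).symm
    exact hd
  -- The factor relating `δ = c d` to `d`. It lies in `K`, so it can be absorbed into `v`.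
  let c : K := 324 * (1800 * a₁) ^ 10
  have hφc : φ c = 324 * (1800 * φ a₁) ^ 10 := by simp [c, _root_.map_ofNat]
  have hδ : (φ c * g) ^ 2 = -(gram₂ (moduliD (φ a₁) (φ a₂) (φ a₃)) * gramDet (moduliA (φ a₁))
      (moduliB (φ a₁) (φ a₂)) (moduliC (φ a₁) (φ a₂) (φ a₃))
      (moduliD (φ a₁) (φ a₂) (φ a₃))) := by
    rw [mul_pow, hg, hφc, mul_dSq_eq (ne_zero_of_algebraicIndependent hjL)]
  have hδ' : (-(φ c * g)) ^ 2 = -(gram₂ (moduliD (φ a₁) (φ a₂) (φ a₃)) * gramDet (moduliA (φ a₁))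
      (moduliB (φ a₁) (φ a₂)) (moduliC (φ a₁) (φ a₂) (φ a₃))
      (moduliD (φ a₁) (φ a₂) (φ a₃))) := by
    rw [neg_sq, hδ]
  obtain ⟨Cp, hp, hp₁, hp₂, hp₃⟩ := exists_curve_mestreSextic hjL hδ
  obtain ⟨Cm, hm, hm₁, hm₂, hm₃⟩ := exists_curve_mestreSextic hjL hδ'
  rw [mestreSextic_eq_add hδ] at hp
  rw [mestreSextic_eq_add hδ'] at hm
  refine ⟨Cp, Cm, ?_, ⟨mestreU (moduliA a₁) (moduliB a₁ a₂) (moduliC a₁ a₂ a₃)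
    (moduliD a₁ a₂ a₃), Polynomial.C c * mestreV (moduliA a₁) (moduliB a₁ a₂)
    (moduliC a₁ a₂ a₃) (moduliD a₁ a₂ a₃), ?_, ?_⟩, ?_, ?_, ?_, ?_, ?_, ?_⟩
  · intro h
    have h := congrArg (fun Cv : Curve L => Cv.sextic.coeff 6) h
    simp only [hp, hm, coeff_add, coeff_C_mul, coeff_six_mestreV] at h
    have h₀ : φ c * g ≠ 0 := fun h₀ => by
      rw [h₀, zero_pow two_ne_zero] at hδ
      exact neg_ne_zero.mpr (mul_ne_zero (gram₂_moduli_ne_zero hjL)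
        (gramDet_moduli_ne_zero hjL)) hδ.symm
    refine mul_ne_zero (mul_ne_zero two_ne_zero h₀) (leadV_moduli_ne_zero hjL) ?_
    linear_combination h
  · rw [hp, Polynomial.map_mul, map_mestreU, map_mestreV, Polynomial.map_C]
    simp only [← map_moduliA, ← map_moduliB, ← map_moduliC, ← map_moduliD, map_mul]
    change _ + Polynomial.C (φ c) * Polynomial.C g * _ = _ +
      Polynomial.C g * (Polynomial.C (φ c) * _)
    ring
  · rw [hm, Polynomial.map_mul, map_mestreU, map_mestreV, Polynomial.map_C]
    simp only [← map_moduliA, ← map_moduliB, ← map_moduliC, ← map_moduliD, map_neg, map_mul]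
    change _ + -(Polynomial.C (φ c) * Polynomial.C g) * _ =
      _ - Polynomial.C g * (Polynomial.C (φ c) * _)
    ring
  · rw [hp₁]; rfl
  · rw [hp₂]; rfl
  · rw [hp₃]; rfl
  · rw [hm₁]; rfl
  · rw [hm₂]; rfl
  · rw [hm₃]; rfl
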